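/- Algorithms are deterministic programs with unit-cost elementary operations (WHILE programs on binary trees, equivalent up to polylogarithmic factors in the running time to word-RAM programs). "In $2^{\delta n}$ time" means in time at most $2^{\delta n}\cdot q(\ell)$ for some polynomial $q$, where $\ell$ is the length of the encoded input and $n$ is the parameter named below. For $p\in[1,\infty)$, $\mathrm{CVP}_p$ is the following problem: given a matrix $B\in\mathbb{Q}^{d\times n}$ with linearly independent columns, a target $\vec t\in\mathbb{Q}^d$ and a rational number $r>0$ (all in binary), decide whether $\min_{\vec z\in\mathbb{Z}^n}\|B\vec z-\vec t\|_p\le r$. Its parameter is the rank $n$ of the lattice $B\mathbb{Z}^n$. A $k$-clause is a disjunction of $k$ literals, not necessarily distinct. $k$-SAT is the problem of deciding whether a conjunction of $k$-clauses on $n$ variables is satisfiable. Weighted Max-$k$-SAT is the following problem: given $k$-clauses $C_1,\dots,C_m$ on $n$ variables with non-negative integer weights $w_1,\dots,w_m$ and a threshold $W\in\mathbb{Z}_{\ge0}$ (weights and threshold in binary), decide whether some assignment satisfies clauses of total weight at least $W$. The parameter of both is the number $n$ of variables. SETH is the hypothesis that for every $\varepsilon>0$ there is $k\in\mathbb{Z}^+$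 such that no algorithm solves $k$-SAT in $2^{(1-\varepsilon)n}$ time. W-Max-SAT-SETH is the hypothesis that for every $\varepsilon>0$ there is $k\in\mathbb{Z}^+$ such that no algorithm solves weighted Max-$k$-SAT in $2^{(1-\varepsilon)n}$ time. A real number $p$ is computable if there is an algorithm that, given $m\in\mathbb{N}$, outputs an integer $a$ with $|p-a/2^m|\le 2^{-m}$. **Corollary.** For every $\varepsilon>0$ and every computable $p\in[1,\infty)\setminus2\mathbb{Z}$, there is no $2^{(1-\varepsilon)n}$-time algorithm for $\mathrm{CVP}_p$, assuming W-Max-SAT-SETH. In particular, for all such $\varepsilon$ and $p$, there is no $2^{(1-\varepsilon)n}$-time algorithm for $\mathrm{CVP}_p$, assuming SETH. -/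

import Mathlib

open scoped Matrix

namespace FineGrained

/-! ## Algorithms and running time

Algorithms are programs of the textbook WHILE language over binary trees (N. D. Jones,
*Computability and Complexity from a Programming Perspective*).  A tree is handled through pointers
(`cons` builds one new cell, nothing is copied, and there is no equality test on trees), and every
elementary operation costs one unit of time.  A word RAM with words of length `O(log T)` executes
`T` steps in time `O(T)`, and `T` steps of such a RAM are simulated in time `T * polylog T`; so
running times of the form `2 ^ (δ * n) * poly` do not depend on which of the two models is used. -/

/-- Binary trees, the values that programs work on. -/
inductive Data : Type
  | nil : Data
  | cons : Data → Data → Data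

namespace Data

/-- The first component of a pair; `nil` for `nil`. -/
def hd : Data → Data
  | nil => nil
  | cons a _ => a

/-- The second component of a pair; `nil` for `nil`. -/
def tl : Data → Data
  | nil => nil
  | cons _ b => b

/-- The size of a tree: its number of nodes, leaves included. -/
def size : Data → ℕ
  | nil => 1
  | cons a b => a.size + b.size + 1

end Data

/-- A store gives the value of each variable. -/
abbrev Store : Type := ℕ → Data

/-- Expressions. -/
inductive Exp : Type
  | var : ℕ → Exp
  | nil : Exp
  | cons : Exp → Exp → Exp
  | hd : Exp → Exp
  | tl : Exp → Exp

namespace Exp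

/-- The value of an expression in a store. -/
def value : Exp → Store → Data
  | var i, s => s i
  | nil, _ => Data.nil
  | cons e f, s => Data.cons (e.value s) (f.value s)
  | hd e, s => (e.value s).hd
  | tl e, s => (e.value s).tl

/-- The time needed to evaluate an expression: one unit for each operation. -/
def cost : Exp → ℕ
  | var _ => 1
  | nil => 1
  | cons e f => e.cost + f.cost + 1
  | hd e => e.cost + 1
  | tl e => e.cost + 1

end Exp

/-- Programs: assignment, sequence, conditional, and loop.  In tests, `nil` means false and every
other value means true. -/
inductive Prog : Type
  | assign : ℕ → Exp → Prog
  | seq : Prog → Prog → Prog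
  | cond : Exp → Prog → Prog → Prog
  | loop : Exp → Prog → Prog

/-- `Exec c s s' t`: program `c`, started in the store `s`, halts in the store `s'` after `t` units
of time. -/
inductive Exec : Prog → Store → Store → ℕ → Prop
  | assign (i : ℕ) (e : Exp) (s : Store) :
      Exec (Prog.assign i e) s (Function.update s i (e.value s)) (e.cost + 1)
  | seq {c d : Prog} {s s₁ s₂ : Store} {a b : ℕ} :
      Exec c s s₁ a → Exec d s₁ s₂ b → Exec (Prog.seq c d) s s₂ (a + b)
  | cond_true {e : Exp} {c d : Prog} {s s₁ : Store} {a : ℕ} :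
      e.value s ≠ Data.nil → Exec c s s₁ a → Exec (Prog.cond e c d) s s₁ (e.cost + 1 + a)
  | cond_false {e : Exp} {c d : Prog} {s s₁ : Store} {a : ℕ} :
      e.value s = Data.nil → Exec d s s₁ a → Exec (Prog.cond e c d) s s₁ (e.cost + 1 + a)
  | loop_true {e : Exp} {c : Prog} {s s₁ s₂ : Store} {a b : ℕ} :
      e.value s ≠ Data.nil → Exec c s s₁ a → Exec (Prog.loop e c) s₁ s₂ b →
        Exec (Prog.loop e c) s s₂ (e.cost + 1 + a + b)
  | loop_false {e : Exp} {c : Prog} {s : Store} :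
      e.value s = Data.nil → Exec (Prog.loop e c) s s (e.cost + 1)

/-- The input is placed in variable `0`; all other variables are `nil` at the start. -/
def initStore (x : Data) : Store := Function.update (fun _ => Data.nil) 0 x

/-- `Outputs c x y t`: on input `x`, the program `c` halts after `t` units of time, and then
variable `0` holds `y`. -/
def Outputs (c : Prog) (x y : Data) (t : ℕ) : Prop :=
  ∃ s : Store, Exec c (initStore x) s t ∧ s 0 = y

/-! ## Encodings -/

/-- A bit. -/
def encBool : Bool → Data
  | false => Data.nil
  | true => Data.cons Data.nil Data.nil

/-- A list of trees as one tree. -/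
def encList : List Data → Data
  | [] => Data.nil
  | a :: l => Data.cons a (encList l)

/-- A natural number in unary; used only for the number of variables of a formula and for the
indices of variables. -/
def encUnary (n : ℕ) : Data := encList (List.replicate n Data.nil)

/-- A natural number in binary. -/
def encNat (n : ℕ) : Data := encList (n.bits.map encBool)

/-- An integer: sign and absolute value in binary. -/
def encInt (z : ℤ) : Data := Data.cons (encBool (decide (z < 0))) (encNat z.natAbs)

/-- A rational number: numerator and denominator, in lowest terms and in binary. -/
def encRat (q : ℚ) : Data := Data.cons (encInt q.num) (encNat q.den)

/-- A rational vector: the list of its coordinates. -/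
def encVec {d : ℕ} (v : Fin d → ℚ) : Data := encList (List.ofFn fun i => encRat (v i))

/-- A rational matrix: the list of its columns. -/
def encMatrix {d n : ℕ} (B : Matrix (Fin d) (Fin n) ℚ) : Data :=
  encList (List.ofFn fun j => encVec fun i => B i j)

/-! ## Decision problems with a parameter -/

/-- A decision problem: instances with their encoding, the parameter in which the running time is
measured (number of variables, rank), and the set of YES instances.  A promise on the input is part
of the type of instances; all other instances are NO instances. -/
structure Problem where
  /-- The instances. -/
  Inst : Type
  /-- The input given to the algorithm. -/
  encode : Inst → Data
  /-- The parameter `n`. -/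
  param : Inst → ℕ
  /-- The YES instances. -/
  Yes : Inst → Prop

/-- There is an algorithm that decides the problem `P` in time `2 ^ (δ * n)` up to a factor that is
polynomial in the length of the input, where `n` is the parameter of the instance. -/
def Problem.SolvableInTimeTwoPow (P : Problem) (δ : ℝ) : Prop :=
  ∃ (c : Prog) (q : Polynomial ℕ), ∀ I : P.Inst, ∃ (b : Bool) (t : ℕ),
    Outputs c (P.encode I) (encBool b) t ∧ (b = true ↔ P.Yes I) ∧
      (t : ℝ) ≤ (2 : ℝ) ^ (δ * (P.param I : ℝ)) * ((q.eval (P.encode I).size : ℕ) : ℝ)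

/-! ## Satisfiability -/

/-- A clause of `k` literals on `n` variables, not necessarily distinct.  The literal `(j, true)` is
the variable `x_j` and `(j, false)` is its negation. -/
abbrev Clause (k n : ℕ) : Type := Fin k → Fin n × Bool

/-- Whether the assignment `y` satisfies the clause `C`, i.e. at least one of its literals. -/
def Clause.sat {k n : ℕ} (C : Clause k n) (y : Fin n → Bool) : Bool :=
  decide (∃ i : Fin k, y (C i).1 = (C i).2)

/-- A clause: the list of its literals, each a sign and an index. -/
def encClause {k n : ℕ} (C : Clause k n) : Data :=
  encList (List.ofFn fun i => Data.cons (encBool (C i).2) (encUnary ((C i).1 : ℕ)))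

/-- A `k`-SAT formula. -/
structure KCNF (k : ℕ) : Type where
  /-- The number of variables. -/
  n : ℕ
  /-- The clauses. -/
  clauses : List (Clause k n)

/-- `k`-SAT, parametrized by the number of variables. -/
def kSAT (k : ℕ) : Problem where
  Inst := KCNF k
  encode Φ := Data.cons (encUnary Φ.n) (encList (Φ.clauses.map encClause))
  param Φ := Φ.n
  Yes Φ := ∃ y : Fin Φ.n → Bool, ∀ C ∈ Φ.clauses, C.sat y = true

/-- An instance of weighted Max-`k`-SAT: a `k`-SAT formula with a weight for each clause, and a
threshold. -/
structure WeightedKCNF (k : ℕ) : Type where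
  /-- The number of variables. -/
  n : ℕ
  /-- The clauses with their weights. -/
  clauses : List (ℕ × Clause k n)
  /-- The total weight that is to be reached. -/
  threshold : ℕ

/-- The total weight of the clauses that the assignment `y` satisfies. -/
def WeightedKCNF.weight {k : ℕ} (Φ : WeightedKCNF k) (y : Fin Φ.n → Bool) : ℕ :=
  (Φ.clauses.map fun c => if c.2.sat y = true then c.1 else 0).sum

/-- Weighted Max-`k`-SAT, parametrized by the number of variables: is there an assignment that
satisfies clauses of total weight at least the threshold?  Weights and threshold are given in
binary. -/
def weightedMaxKSAT (k : ℕ) : Problem where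
  Inst := WeightedKCNF k
  encode Φ := Data.cons (encUnary Φ.n)
    (Data.cons (encList (Φ.clauses.map fun c => Data.cons (encNat c.1) (encClause c.2)))
      (encNat Φ.threshold))
  param Φ := Φ.n
  Yes Φ := ∃ y : Fin Φ.n → Bool, Φ.threshold ≤ Φ.weight y

/-- The Strong Exponential Time Hypothesis: for every `ε > 0` there is a `k` such that no algorithm
solves `k`-SAT on `n` variables in time `2 ^ ((1 - ε) * n)`. -/
def SETH : Prop :=
  ∀ ε : ℝ, 0 < ε → ∃ k : ℕ, 1 ≤ k ∧ ¬ (kSAT k).SolvableInTimeTwoPow (1 - ε)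

/-- The same hypothesis for weighted Max-`k`-SAT in place of `k`-SAT. -/
def WMaxSATSETH : Prop :=
  ∀ ε : ℝ, 0 < ε → ∃ k : ℕ, 1 ≤ k ∧ ¬ (weightedMaxKSAT k).SolvableInTimeTwoPow (1 - ε)

/-! ## The closest vector problem -/

/-- The `ℓ_p` norm on `ℝ ^ d`, for a real number `p ≥ 1`. -/
noncomputable def lpNorm (p : ℝ) {d : ℕ} (v : Fin d → ℝ) : ℝ :=
  ‖WithLp.toLp (ENNReal.ofReal p) v‖

/-- The lattice generated by the columns of `B`. -/
def latticeOf {d n : ℕ} (B : Matrix (Fin d) (Fin n) ℝ) : Set (Fin d → ℝ) :=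
  Set.range fun z : Fin n → ℤ => B *ᵥ (fun j => (z j : ℝ))

/-- The `ℓ_p` distance of `t` to `L`. -/
noncomputable def lpDist (p : ℝ) {d : ℕ} (L : Set (Fin d → ℝ)) (t : Fin d → ℝ) : ℝ :=
  sInf ((fun x => lpNorm p (x - t)) '' L)

/-- An instance of the closest vector problem: a basis (the columns of `B`) of a lattice of rank `n`
in `ℝ ^ d`, a target `t` and a number `r > 0`.  Inputs of algorithms are finite, so the numbers are
rational. -/
structure CVPInstance : Type where
  /-- The dimension. -/
  d : ℕ
  /-- The rank. -/
  n : ℕ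
  /-- The basis. -/
  B : Matrix (Fin d) (Fin n) ℚ
  /-- The target. -/
  t : Fin d → ℚ
  /-- The distance bound. -/
  r : ℚ
  linearIndependent : LinearIndependent ℝ fun (j : Fin n) (i : Fin d) => (B i j : ℝ)
  r_pos : 0 < r

/-- The closest vector problem in the `ℓ_p` norm, parametrized by the rank of the lattice. -/
def CVP (p : ℝ) : Problem where
  Inst := CVPInstance
  encode I := Data.cons (encMatrix I.B) (Data.cons (encVec I.t) (encRat I.r))
  param I := I.n
  Yes I := lpDist p (latticeOf (I.B.map fun q : ℚ => (q : ℝ))) (fun i => (I.t i : ℝ)) ≤ (I.r : ℝ)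

/-- A real number is computable if an algorithm finds, for each `m`, a rational number within
`2 ^ (-m)` of it. -/
def IsComputableReal (x : ℝ) : Prop :=
  ∃ f : ℕ → ℤ, Computable f ∧ ∀ m : ℕ, |x - (f m : ℝ) / 2 ^ m| ≤ 1 / 2 ^ m

end FineGrained

namespace FineGrained

/-! ## Polynomial-time functions between encoded types -/

/-! A fast algorithm for `CVP p` is turned into an equally fast one for weighted Max-`k`-SAT by a
polynomial-time reduction whose lattice rank is the number of variables
(`weightedMaxKSAT_solvable`). SETH implies W-Max-SAT-SETH by weighting the clauses so that only full
satisfaction reaches the threshold (`kSAT_solvable`).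

The geometric core is `exists_gadget`. Since `p` is not an even integer, there are finitely many
integer affine forms in `k` signs whose `p`-th powers sum to `A + D` when all signs are `-1`, and to
`A` otherwise. Reading the signs as truth values of literals, such a gadget detects a violated
clause. It exists because otherwise some finite difference of `|m| ^ p` would vanish identically,
which makes `|m| ^ p` a polynomial on the even integers and forces `p` to be even.

The lattice has one coordinate `a * (2 * z j - 1)` per variable, with `a` so large that only `z j ∈
{0, 1}` can be close, and for each clause of weight `w` the gadget rows scaled by `w ^ (1 / p)`. The
`p`-th power of the distance is then an affine decreasing function of the satisfied weight. The
factors `w ^ (1 / p)` are irrational, so everything is multiplied by a large `M` and rounded;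
`div_le_rpow_sub_rpow` shows that the gap between YES and NO survives (`reduction_spec`).

The roots and the distance bound are computed with the assumed `CVP p` algorithm itself. On lattices
of rank `0` it runs in polynomial time and compares `p`-norms of integer vectors with integers.
Binary search then gives rounded norms, and `N * (2 * n + b) ^ (1 / p)` is the norm of `(x, x, b *
N)` with `x = N * n ^ (1 / p)`, so roots are found bit by bit (`rootScale_approx`). The distance
bound is the rounded norm of a vector built from the same gadgets, so the values of `A` and `D` are
never computed. -/

theorem eval_polynomial_mono (q : Polynomial ℕ) : Monotone fun n => q.eval n := by
  intro a b h
  simp only [Polynomial.eval_eq_sum_range]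
  gcongr

/-- A type whose elements are encoded as trees. -/
class Enc (α : Type) where
  /-- The encoding. -/
  enc : α → Data

/-- The program `c` replaces the content `x` of variable `0` by `y` in time `t`; it needs the
variables between `0` and `N` to be `nil`, and it leaves all variables but `0` unchanged. -/
def Runs (N : ℕ) (c : Prog) (x y : Data) (t : ℕ) : Prop :=
  ∀ s : Store, s 0 = x → (∀ i, 0 < i → i < N → s i = Data.nil) →
    Exec c s (Function.update s 0 y) t

theorem Runs.mono {N N' : ℕ} {c : Prog} {x y : Data} {t : ℕ} (h : Runs N c x y t) (hN : N ≤ N') :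
    Runs N' c x y t :=
  fun s h0 hs => h s h0 fun i hi hi' => hs i hi (hi'.trans_le hN)

theorem Exec.cast {c : Prog} {s s₁ s₂ : Store} {t t' : ℕ} (h : Exec c s s₁ t) (hs : s₁ = s₂)
    (ht : t = t') : Exec c s s₂ t' := hs ▸ ht ▸ h

open Enc (enc)

/-- The size of the encoding of `a`. -/
def esize {α : Type} [Enc α] (a : α) : ℕ := (enc a).size

/-- `f` is computed by a program in polynomial time, and the size of its value is polynomially
bounded. -/
def PolyTime {α β : Type} [Enc α] [Enc β] (f : α → β) : Prop :=
  ∃ (c : Prog) (N : ℕ) (q : Polynomial ℕ), ∀ a,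
    (∃ t, Runs N c (enc a) (enc (f a)) t ∧ t ≤ q.eval (esize a)) ∧ esize (f a) ≤ q.eval (esize a)

instance : Enc Bool := ⟨encBool⟩
instance : Enc Unit := ⟨fun _ => Data.nil⟩
instance {α β : Type} [Enc α] [Enc β] : Enc (α × β) := ⟨fun x => Data.cons (enc x.1) (enc x.2)⟩
instance {α : Type} [Enc α] : Enc (List α) := ⟨fun l => encList (l.map enc)⟩
instance : Enc ℕ := ⟨encNat⟩
instance : Enc ℤ := ⟨encInt⟩
instance : Enc ℚ := ⟨encRat⟩

/-! ### Building blocks for polynomial-time programs. -/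

section Basic
variable {α β γ σ : Type} [Enc α] [Enc β] [Enc γ] [Enc σ]

theorem enc_pair (a : α) (b : β) : enc (a, b) = Data.cons (enc a) (enc b) := rfl
theorem enc_list_nil : enc ([] : List α) = Data.nil := rfl
theorem enc_list_cons (a : α) (l : List α) : enc (a :: l) = Data.cons (enc a) (enc l) := rfl

theorem esize_pos (a : α) : 0 < esize a := by
  unfold esize; cases enc a <;> simp [Data.size]

@[simp] theorem esize_pair (a : α) (b : β) : esize (a, b) = esize a + esize b + 1 := rfl
@[simp] theorem esize_nil : esize ([] : List α) = 1 := rfl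
@[simp] theorem esize_cons (a : α) (l : List α) : esize (a :: l) = esize a + esize l + 1 := rfl
theorem esize_bool_le (b : Bool) : esize b ≤ 3 := by cases b <;> decide

theorem length_lt_esize (l : List α) : l.length < esize l := by
  induction l with
  | nil => simp
  | cons a l ih => simp; omega

/-- A program sees only encodings, so objects of different types with the same encoding can be
exchanged at no cost. This lets formulas and lattice instances be handled as nested pairs and lists.
-/
theorem PolyTime.congr_enc {f : α → β} {g : α → γ} (hg : PolyTime g)
    (h : ∀ a, enc (f a) = enc (g a)) : PolyTime f := by
  obtain ⟨c, N, q, H⟩ := hg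
  refine ⟨c, N, q, fun a => ?_⟩
  have := H a
  simpa only [esize, h a] using this

theorem PolyTime.of_eq {f g : α → β} (hg : PolyTime g) (h : ∀ a, f a = g a) : PolyTime f :=
  (funext h : f = g) ▸ hg

theorem PolyTime.comp {f : β → γ} {g : α → β} (hf : PolyTime f) (hg : PolyTime g) :
    PolyTime fun a => f (g a) := by
  obtain ⟨c, N, q, H⟩ := hf
  obtain ⟨c', N', q', H'⟩ := hg
  refine ⟨Prog.seq c' c, max N N', q' + q.comp q', fun a => ?_⟩
  obtain ⟨⟨t', h1', h2'⟩, h3'⟩ := H' a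
  obtain ⟨⟨t, h1, h2⟩, h3⟩ := H (g a)
  have hm := eval_polynomial_mono q h3'
  simp only [Polynomial.eval_add, Polynomial.eval_comp] at hm ⊢
  refine ⟨⟨t' + t, fun s h0 hs => ?_, by omega⟩, by omega⟩
  refine (Exec.seq (h1'.mono (le_max_right _ _) s h0 hs)
    (h1.mono (N' := max N N') (le_max_left _ _) _ (by simp) fun i hi hi' => ?_)).cast
      (by simp) rfl
  rw [Function.update_of_ne hi.ne']
  exact hs i hi hi'

theorem PolyTime.of_exp {f : α → β} (e : Exp) (q : Polynomial ℕ)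
    (he : ∀ a (s : Store), s 0 = enc a → e.value s = enc (f a))
    (hq : ∀ a, esize (f a) ≤ q.eval (esize a)) : PolyTime f := by
  refine ⟨Prog.assign 0 e, 0, q + Polynomial.C (e.cost + 1), fun a => ?_⟩
  simp only [Polynomial.eval_add, Polynomial.eval_C]
  refine ⟨⟨e.cost + 1, fun s h0 _ => ?_, by omega⟩, by have := hq a; omega⟩
  exact (Exec.assign 0 e s).cast (by rw [he a s h0]) rfl

theorem PolyTime.id : PolyTime fun a : α => a :=
  .of_exp (Exp.var 0) Polynomial.X (fun _ _ h => h) fun _ => by simp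

theorem PolyTime.fst : PolyTime (Prod.fst : α × β → α) :=
  .of_exp (Exp.hd (Exp.var 0)) Polynomial.X (fun a s h => by simp [Exp.value, h, enc, Data.hd])
    fun a => by obtain ⟨a, b⟩ := a; simp; omega

theorem PolyTime.snd : PolyTime (Prod.snd : α × β → β) :=
  .of_exp (Exp.tl (Exp.var 0)) Polynomial.X (fun a s h => by simp [Exp.value, h, enc, Data.tl])
    fun a => by obtain ⟨a, b⟩ := a; simp; omega

/-- The expression with a given constant value. -/
def Exp.const : Data → Exp
  | Data.nil => Exp.nil
  | Data.cons a b => Exp.cons (Exp.const a) (Exp.const b)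

theorem Exp.value_const (d : Data) (s : Store) : (Exp.const d).value s = d := by
  induction d with
  | nil => rfl
  | cons a b iha ihb => simp [Exp.const, Exp.value, iha, ihb]

theorem PolyTime.const (b : β) : PolyTime fun _ : α => b :=
  .of_exp (Exp.const (enc b)) (Polynomial.C (esize b)) (fun _ _ _ => Exp.value_const _ _)
    fun _ => by simp

/-- Variable `N` keeps the input during the first run, and `N + 1` keeps the first result during the
second. Both lie above the variables that the two programs need to be `nil`, and both are cleared at
the end. -/
theorem PolyTime.pair {f : α → β} {g : α → γ} (hf : PolyTime f) (hg : PolyTime g) :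
    PolyTime fun a => (f a, g a) := by
  obtain ⟨c, N₁, q, H⟩ := hf
  obtain ⟨c', N₂, q', H'⟩ := hg
  obtain ⟨N, hN⟩ : ∃ N, N = max (max N₁ N₂) 1 := ⟨_, rfl⟩
  refine ⟨.seq (.assign N (.var 0)) (.seq c (.seq (.assign (N + 1) (.var 0))
    (.seq (.assign 0 (.var N)) (.seq c' (.seq (.assign 0 (.cons (.var (N + 1)) (.var 0)))
      (.seq (.assign N .nil) (.assign (N + 1) .nil))))))), N + 2, q + q' + 14, fun a => ?_⟩
  obtain ⟨⟨t, h1, h2⟩, h3⟩ := H a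
  obtain ⟨⟨t', h1', h2'⟩, h3'⟩ := H' a
  have h14 : (14 : Polynomial ℕ) = Polynomial.C 14 := rfl
  rw [h14]
  simp only [Polynomial.eval_add, Polynomial.eval_C, esize_pair]
  refine ⟨⟨2 + (t + (2 + (2 + (t' + (4 + (2 + 2)))))), fun s h0 hs => ?_, by omega⟩, by omega⟩
  have hN0 : N ≠ 0 := by omega
  have hN1 : N + 1 ≠ N := by omega
  refine (Exec.seq (Exec.assign _ _ _) (Exec.seq (h1.mono (N' := N) (by omega) _ ?_ ?_)
    (Exec.seq (Exec.assign _ _ _) (Exec.seq (Exec.assign _ _ _)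
      (Exec.seq (h1'.mono (N' := N) (by omega) _ ?_ ?_) (Exec.seq (Exec.assign _ _ _)
        (Exec.seq (Exec.assign _ _ _) (Exec.assign _ _ _)))))))).cast ?_ rfl
  · rw [Function.update_of_ne hN0.symm, h0]
  · intro i hi hi'
    rw [Function.update_of_ne hi'.ne, hs i hi (by omega)]
  · simp [Exp.value, h0, hN0]
  · intro i hi hi'
    have : i ≠ N + 1 := by omega
    simp [hi.ne', hi'.ne, hs i hi (by omega), this]
  · have e1 := hs N (by omega) (by omega)
    have e2 := hs (N + 1) (by omega) (by omega)
    funext i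
    rcases eq_or_ne i 0 with rfl | hi
    · simp [Exp.value, hN0.symm, enc_pair, hN0]
    · rcases eq_or_ne i N with rfl | hiN
      · simp [Exp.value, hi, e1]
      · rcases eq_or_ne i (N + 1) with rfl | hiN1
        · simp [Exp.value, Function.update_apply, e2]
        · simp [Exp.value, Function.update_apply, hi, hiN, hiN1]

theorem PolyTime.ite {b : α → Bool} {f g : α → β} (hb : PolyTime b) (hf : PolyTime f)
    (hg : PolyTime g) : PolyTime fun a => if b a = true then f a else g a := by
  have key : PolyTime fun x : Bool × α => if x.1 = true then f x.2 else g x.2 := by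
    obtain ⟨c, N₁, q, H⟩ := hf.comp (PolyTime.snd (α := Bool))
    obtain ⟨c', N₂, q', H'⟩ := hg.comp (PolyTime.snd (α := Bool))
    refine ⟨.cond (.hd (.var 0)) c c', max N₁ N₂, q + q' + Polynomial.C 3, fun a => ?_⟩
    obtain ⟨b, a⟩ := a
    simp only [Polynomial.eval_add, Polynomial.eval_C]
    cases b with
    | true =>
      obtain ⟨⟨t, h1, h2⟩, h3⟩ := H (true, a)
      simp only at h1 h2 h3
      simp only [if_true]
      refine ⟨⟨2 + 1 + t, fun s h0 hs => ?_, by omega⟩, by omega⟩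
      exact Exec.cond_true (by simp [Exp.value, h0, enc, Data.hd, encBool])
        (h1.mono (le_max_left _ _) s h0 hs)
    | false =>
      obtain ⟨⟨t, h1, h2⟩, h3⟩ := H' (false, a)
      simp only at h1 h2 h3
      simp only [Bool.false_eq_true, if_false]
      refine ⟨⟨2 + 1 + t, fun s h0 hs => ?_, by omega⟩, by omega⟩
      exact Exec.cond_false (by simp [Exp.value, h0, enc, Data.hd, encBool])
        (h1.mono (le_max_right _ _) s h0 hs)
  exact key.comp (hb.pair PolyTime.id)

/-- Iteration over a list, when the size of the intermediate states is polynomially bounded. -/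
theorem PolyTime.foldl_of_bound {l : γ → List α} {s₀ : γ → σ} {f : γ × σ × α → σ}
    (hl : PolyTime l) (hs : PolyTime s₀) (hf : PolyTime f) (q : Polynomial ℕ)
    (hq : ∀ g l', l' <+: l g →
      esize (l'.foldl (fun s a => f (g, s, a)) (s₀ g)) ≤ q.eval (esize g)) :
    PolyTime fun g => (l g).foldl (fun s a => f (g, s, a)) (s₀ g) := by
  have hin := PolyTime.id.pair (hs.pair hl)
  obtain ⟨c₀, N₀, q₀, H₀⟩ := hin
  obtain ⟨c, N₁, r, H⟩ := hf
  obtain ⟨N, hN⟩ : ∃ N, N = max N₁ 1 := ⟨_, rfl⟩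
  have hN0 : N ≠ 0 := by omega
  have hN1 : N + 1 ≠ N := by omega
  -- Variable `0` holds the state, `N` the rest of the list, `N + 1` the parameter `g`. With `B`
  -- bounding the inputs and `B'` all intermediate states, one bound on the cost of a step serves
  -- the whole induction.
  have loop : ∀ (g : γ) (B B' : ℕ) (l : List α) (a₀ : σ), esize g + esize l ≤ B →
      (∀ l', l' <+: l → esize (l'.foldl (fun s a => f (g, s, a)) a₀) ≤ B') →
      ∃ t, t ≤ 3 + l.length * (14 + r.eval (B + B' + 2)) ∧
        ∀ s : Store, s 0 = enc a₀ → s N = enc l → s (N + 1) = enc g →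
          (∀ i, 0 < i → i < N → s i = Data.nil) →
          Exec (.loop (.var N) (.seq (.assign 0 (.cons (.var (N + 1)) (.cons (.var 0)
            (.hd (.var N))))) (.seq (.assign N (.tl (.var N))) c))) s
            (Function.update (Function.update s N Data.nil) 0
              (enc (l.foldl (fun s a => f (g, s, a)) a₀))) t := by
    intro g B B' l
    induction l with
    | nil =>
      intro a₀ _ _
      refine ⟨2, by simp, fun s h0 hN _ _ => ?_⟩
      refine (Exec.loop_false ?_).cast ?_ rfl
      · simpa [Exp.value] using hN.trans enc_list_nil
      · rw [enc_list_nil] at hN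
        rw [← hN, Function.update_eq_self, List.foldl_nil, ← h0, Function.update_eq_self]
    | cons a l ih =>
      intro a₀ hB hB'
      simp only [esize_cons] at hB
      obtain ⟨t, ht, hE⟩ := ih (f (g, a₀, a)) (by omega) fun l' hl' =>
        hB' (a :: l') (List.cons_prefix_cons.2 ⟨rfl, hl'⟩)
      obtain ⟨⟨t', h1, h2⟩, -⟩ := H (g, a₀, a)
      have h3 : esize a₀ ≤ B' := hB' [] (List.nil_prefix)
      have h5 : r.eval (esize (g, a₀, a)) ≤ r.eval (B + B' + 2) :=
        eval_polynomial_mono r (by simp only [esize_pair]; omega)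
      refine ⟨1 + 1 + (7 + (3 + t')) + t, ?_, fun s h0 hN' hg hs => ?_⟩
      · simp only [List.length_cons]
        rw [add_mul l.length 1 (14 + _), one_mul]
        omega
      · refine (Exec.loop_true ?_ (Exec.seq (Exec.assign _ _ _) (Exec.seq (Exec.assign _ _ _)
          (h1.mono (N' := N) (by omega) _ ?_ ?_))) (hE _ ?_ ?_ ?_ ?_)).cast ?_ rfl
        · simp [Exp.value, hN', enc_list_cons]
        · simp [Exp.value, Function.update_apply, hN0.symm, h0, hN', hg, enc_pair, enc_list_cons,
            Data.hd]
        · intro i hi hi'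
          simp [hi.ne', hi'.ne, hs i hi hi']
        · simp
        · simp [Exp.value, hN0, hN', enc_list_cons, Data.tl]
        · simp [hg]
        · intro i hi hi'
          simp [hi.ne', hi'.ne, hs i hi hi']
        · funext i
          by_cases hi : i = 0 <;> by_cases hi' : i = N <;> simp [Function.update_apply, hi, hi']
  refine ⟨.seq c₀ (.seq (.assign N (.tl (.tl (.var 0)))) (.seq (.assign (N + 1) (.hd (.var 0)))
    (.seq (.assign 0 (.hd (.tl (.var 0)))) (.seq (.loop (.var N) (.seq (.assign 0 (.cons
      (.var (N + 1)) (.cons (.var 0) (.hd (.var N))))) (.seq (.assign N (.tl (.var N))) c)))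
        (.assign (N + 1) .nil))))), max N₀ (N + 2),
    q₀ + Polynomial.C 16 + q₀ * (Polynomial.C 14 + r.comp (q₀ + q + Polynomial.C 2)) + q,
    fun g => ?_⟩
  obtain ⟨⟨t₀, h1₀, h2₀⟩, h3₀⟩ := H₀ g
  have hB : esize g + esize (l g) ≤ q₀.eval (esize g) := by
    simp only [esize_pair] at h3₀; omega
  obtain ⟨t, ht, hE⟩ := loop g _ _ (l g) (s₀ g) hB (hq g)
  have hsz := hq g (l g) List.prefix_rfl
  have hl : (l g).length ≤ q₀.eval (esize g) := by
    have := length_lt_esize (l g)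
    omega
  have h10 := Nat.mul_le_mul_right (14 + r.eval (q₀.eval (esize g) + q.eval (esize g) + 2)) hl
  simp only [Polynomial.eval_add, Polynomial.eval_mul, Polynomial.eval_C, Polynomial.eval_comp]
  refine ⟨⟨t₀ + (4 + (3 + (4 + (t + 2)))), fun s h0 hs => ?_, by omega⟩, by omega⟩
  refine (Exec.seq (h1₀.mono (N' := max N₀ (N + 2)) (le_max_left _ _) s h0 hs)
    (?_ : Exec _ _ (Function.update (Function.update s 0 (enc (g, s₀ g, l g))) 0 _) _)).cast
      (by rw [Function.update_idem]) rfl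
  have h0 := Function.update_self 0 (enc (g, s₀ g, l g)) s
  have hs : ∀ i, 0 < i → i < N + 2 →
      Function.update s 0 (enc (g, s₀ g, l g)) i = Data.nil := fun i hi hi' => by
    rw [Function.update_of_ne hi.ne', hs i hi (by omega)]
  generalize Function.update s 0 (enc (g, s₀ g, l g)) = s at h0 hs ⊢
  refine (Exec.seq (Exec.assign _ _ _) (Exec.seq (Exec.assign _ _ _) (Exec.seq (Exec.assign _ _ _)
    (Exec.seq (hE _ ?_ ?_ ?_ ?_) (Exec.assign _ _ _))))).cast ?_ rfl
  · simp [Exp.value, hN0.symm, h0, enc_pair, Data.hd, Data.tl]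
  · simp [Exp.value, Function.update_apply, hN0, h0, enc_pair, Data.tl]
  · simp [Exp.value, hN0.symm, h0, enc_pair, Data.hd]
  · intro i hi hi'
    have : i ≠ N + 1 := by omega
    simp [hi.ne', hi'.ne, hs i hi (by omega), this]
  · have e1 := hs N (by omega) (by omega)
    have e2 := hs (N + 1) (by omega) (by omega)
    funext i
    rcases eq_or_ne i 0 with rfl | hi
    · simp
    · rcases eq_or_ne i N with rfl | hiN
      · simp [hi, e1]
      · rcases eq_or_ne i (N + 1) with rfl | hiN1
        · simp [Exp.value, Function.update_apply, e2]
        · simp [Exp.value, Function.update_apply, hi, hiN, hiN1]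

theorem esize_foldl_le {f : γ × σ × α → σ} (q : Polynomial ℕ)
    (hq : ∀ g s a, esize (f (g, s, a)) ≤ esize s + q.eval (esize g + esize a)) (g : γ) (B : ℕ)
    (l : List α) : ∀ s, esize g + esize l ≤ B →
      esize (l.foldl (fun s a => f (g, s, a)) s) ≤ esize s + l.length * q.eval B := by
  induction l with
  | nil => simp
  | cons a l ih =>
    intro s hB
    simp only [esize_cons] at hB
    have h1 := ih (f (g, s, a)) (by omega)
    have h2 := hq g s a
    have h3 : q.eval (esize g + esize a) ≤ q.eval B := eval_polynomial_mono q (by omega)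
    simp only [List.foldl_cons, List.length_cons, add_mul, one_mul]
    omega

theorem esize_le_of_prefix {l l' : List α} (h : l' <+: l) : esize l' ≤ esize l := by
  obtain ⟨t, rfl⟩ := h
  induction l' with
  | nil => exact esize_pos t
  | cons a l ih => simp only [List.cons_append, esize_cons]; omega

/-- Iteration over a list, when each step increases the size of the state by an amount that does
not depend on the state. -/
theorem PolyTime.foldl {l : γ → List α} {s₀ : γ → σ} {f : γ × σ × α → σ}
    (hl : PolyTime l) (hs : PolyTime s₀) (hf : PolyTime f) (q : Polynomial ℕ)
    (hq : ∀ g s a, esize (f (g, s, a)) ≤ esize s + q.eval (esize g + esize a)) :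
    PolyTime fun g => (l g).foldl (fun s a => f (g, s, a)) (s₀ g) := by
  obtain ⟨_, _, q₀, H₀⟩ := PolyTime.id.pair (hs.pair hl)
  refine .foldl_of_bound hl hs hf (q₀ + q₀ * q.comp q₀) fun g l' hl' => ?_
  have h0 := (H₀ g).2
  simp only [esize_pair] at h0
  have h1 := esize_le_of_prefix hl'
  have h2 := esize_foldl_le q hq g (q₀.eval (esize g)) l' (s₀ g) (by omega)
  have h3 : l'.length ≤ q₀.eval (esize g) := by
    have := length_lt_esize l'
    omega
  have h4 := Nat.mul_le_mul_right (q.eval (q₀.eval (esize g))) h3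
  simp only [Polynomial.eval_add, Polynomial.eval_mul, Polynomial.eval_comp]
  omega

/-! ### Arbitrary programs as polynomial-time functions -/

/-- A bound for the variables of an expression. -/
def Exp.bound : Exp → ℕ
  | Exp.var i => i + 1
  | Exp.nil => 0
  | Exp.cons e f => max e.bound f.bound
  | Exp.hd e => e.bound
  | Exp.tl e => e.bound

/-- A bound for the variables of a program. -/
def Prog.bound : Prog → ℕ
  | Prog.assign i e => max (i + 1) e.bound
  | Prog.seq c d => max c.bound d.bound
  | Prog.cond e c d => max e.bound (max c.bound d.bound)
  | Prog.loop e c => max e.bound c.bound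

theorem Exp.value_congr {N : ℕ} {s s' : Store} (h : ∀ i < N, s i = s' i) (e : Exp)
    (he : e.bound ≤ N) : e.value s = e.value s' := by
  induction e with
  | var i => exact h i he
  | nil => rfl
  | cons e f ihe ihf =>
    simp only [Exp.bound, max_le_iff] at he
    simp [Exp.value, ihe he.1, ihf he.2]
  | hd e ih => simp [Exp.value, ih he]
  | tl e ih => simp [Exp.value, ih he]

/-- A program neither reads nor changes the variables beyond its bound. -/
theorem Exec.frame {N : ℕ} {c : Prog} {s s₁ : Store} {t : ℕ} (h : Exec c s s₁ t) :
    ∀ {s' : Store}, c.bound ≤ N → (∀ i < N, s i = s' i) →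
      ∃ s₁', Exec c s' s₁' t ∧ (∀ i < N, s₁ i = s₁' i) ∧ ∀ i, N ≤ i → s₁' i = s' i := by
  induction h with
  | assign i e s =>
    intro s' hN hs
    simp only [Prog.bound, max_le_iff] at hN
    refine ⟨_, Exec.assign i e s', fun j hj => ?_, fun j hj => ?_⟩
    · simp [Function.update_apply, Exp.value_congr hs e hN.2, hs j hj]
    · rw [Function.update_of_ne (by omega)]
  | seq _ _ ih₁ ih₂ =>
    intro s' hN hs
    simp only [Prog.bound, max_le_iff] at hN
    obtain ⟨u, h1, h2, h3⟩ := ih₁ hN.1 hs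
    obtain ⟨v, h4, h5, h6⟩ := ih₂ hN.2 h2
    exact ⟨v, h1.seq h4, h5, fun i hi => (h6 i hi).trans (h3 i hi)⟩
  | cond_true he _ ih =>
    intro s' hN hs
    simp only [Prog.bound, max_le_iff] at hN
    obtain ⟨u, h1, h2⟩ := ih hN.2.1 hs
    exact ⟨u, Exec.cond_true (Exp.value_congr hs _ hN.1 ▸ he) h1, h2⟩
  | cond_false he _ ih =>
    intro s' hN hs
    simp only [Prog.bound, max_le_iff] at hN
    obtain ⟨u, h1, h2⟩ := ih hN.2.2 hs
    exact ⟨u, Exec.cond_false (Exp.value_congr hs _ hN.1 ▸ he) h1, h2⟩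
  | loop_true he _ _ ih₁ ih₂ =>
    intro s' hN hs
    have hN' := hN
    simp only [Prog.bound, max_le_iff] at hN
    obtain ⟨u, h1, h2, h3⟩ := ih₁ hN.2 hs
    obtain ⟨v, h4, h5, h6⟩ := ih₂ hN' h2
    exact ⟨v, Exec.loop_true (Exp.value_congr hs _ hN.1 ▸ he) h1 h4, h5,
      fun i hi => (h6 i hi).trans (h3 i hi)⟩
  | loop_false he =>
    intro s' hN hs
    simp only [Prog.bound, max_le_iff] at hN
    exact ⟨s', Exec.loop_false (Exp.value_congr hs _ hN.1 ▸ he), hs, fun _ _ => rfl⟩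

/-- The program that sets the variables `1, …, n` to `nil`. -/
def Prog.wipe : ℕ → Prog
  | 0 => Prog.assign 0 (Exp.var 0)
  | n + 1 => Prog.seq (Prog.wipe n) (Prog.assign (n + 1) Exp.nil)

theorem Exec.wipe (n : ℕ) (s : Store) :
    Exec (Prog.wipe n) s (fun i => if 0 < i ∧ i ≤ n then Data.nil else s i) (2 * n + 2) := by
  induction n with
  | zero =>
    refine (Exec.assign 0 (Exp.var 0) s).cast ?_ rfl
    funext i
    have : ¬ (0 < i ∧ i ≤ 0) := by omega
    rw [if_neg this]
    simp [Exp.value]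
  | succ n ih =>
    refine (Exec.seq ih (Exec.assign _ _ _)).cast ?_ (by simp [Exp.cost]; ring)
    funext i
    rcases eq_or_ne i (n + 1) with rfl | hi
    · simp [Exp.value]
    · have : (0 < i ∧ i ≤ n + 1) ↔ (0 < i ∧ i ≤ n) := by omega
      simp [Function.update_of_ne hi, this]

/-- A program given by `Outputs` starts in a clean store and may leave anything in its work
variables. `Exec.frame` moves the run to an arbitrary store whose variables below the bound are
clean, and `Prog.wipe` removes what is left behind. The assumed lattice algorithm becomes a
subroutine in this way. -/
theorem PolyTime.of_outputs {f : α → β} (c : Prog) (q q' : Polynomial ℕ)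
    (h : ∀ a, ∃ t, Outputs c (enc a) (enc (f a)) t ∧ t ≤ q.eval (esize a))
    (h' : ∀ a, esize (f a) ≤ q'.eval (esize a)) : PolyTime f := by
  refine ⟨.seq c (.wipe c.bound), c.bound + 1, q + q' + Polynomial.C (2 * c.bound + 2),
    fun a => ?_⟩
  obtain ⟨t, ⟨s₁, hE, hs₁⟩, ht⟩ := h a
  have := h' a
  simp only [Polynomial.eval_add, Polynomial.eval_C]
  refine ⟨⟨t + (2 * c.bound + 2), fun s h0 hs => ?_, by omega⟩, by omega⟩
  obtain ⟨u, h1, h2, h3⟩ := hE.frame (N := c.bound + 1) (s' := s) (Nat.le_succ _) fun i hi => by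
    rcases Nat.eq_zero_or_pos i with rfl | hi0
    · simp [initStore, h0]
    · simp [initStore, hi0.ne', hs i hi0 hi]
  refine (h1.seq (Exec.wipe _ _)).cast ?_ rfl
  funext i
  rcases Nat.eq_zero_or_pos i with rfl | hi0
  · simp [← h2 0 (Nat.succ_pos _), hs₁]
  · rw [Function.update_of_ne hi0.ne']
    split_ifs with hi
    · exact (hs i hi0 (by omega)).symm
    · exact h3 i (by omega)

end Basic

/-! ### Reductions -/

theorem Problem.SolvableInTimeTwoPow.mono {P : Problem} {δ δ' : ℝ} (h : δ ≤ δ')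
    (hP : P.SolvableInTimeTwoPow δ) : P.SolvableInTimeTwoPow δ' := by
  obtain ⟨c, q, H⟩ := hP
  refine ⟨c, q, fun I => ?_⟩
  obtain ⟨b, t, h1, h2, h3⟩ := H I
  refine ⟨b, t, h1, h2, h3.trans ?_⟩
  gcongr
  norm_num

theorem Problem.SolvableInTimeTwoPow.of_reduction {P Q : Problem} {δ : ℝ} (hδ : 0 ≤ δ)
    (hQ : Q.SolvableInTimeTwoPow δ) (f : P.Inst → Q.Inst)
    (hf : @PolyTime P.Inst Q.Inst ⟨P.encode⟩ ⟨Q.encode⟩ f)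
    (hparam : ∀ I, Q.param (f I) = P.param I) (hYes : ∀ I, Q.Yes (f I) ↔ P.Yes I) :
    P.SolvableInTimeTwoPow δ := by
  obtain ⟨c, q, H⟩ := hQ
  obtain ⟨c', N, q', H'⟩ := hf
  refine ⟨.seq c' c, q' + q.comp q', fun I => ?_⟩
  obtain ⟨b, t, ⟨s, h1, h2⟩, h3, h4⟩ := H (f I)
  obtain ⟨⟨t', h1', h2'⟩, h3'⟩ := H' I
  refine ⟨b, t' + t, ⟨s, ?_, h2⟩, h3.trans (hYes I), ?_⟩
  · refine (h1' (initStore (P.encode I)) (by simp [initStore, enc]) fun i hi _ => by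
      simp [initStore, hi.ne']).seq ?_
    simpa [initStore] using h1
  · have h5 : ((q.eval (Q.encode (f I)).size : ℕ) : ℝ) ≤
        ((q.eval (q'.eval (P.encode I).size) : ℕ) : ℝ) := by
      exact_mod_cast eval_polynomial_mono q h3'
    have h6 : (t' : ℝ) ≤ ((q'.eval (P.encode I).size : ℕ) : ℝ) := by exact_mod_cast h2'
    -- As `0 ≤ δ`, the exponential factor is at least `1` and absorbs the time of the reduction
    -- itself.
    have h7 : (1 : ℝ) ≤ 2 ^ (δ * (P.param I : ℝ)) :=
      Real.one_le_rpow (by norm_num) (by positivity)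
    rw [hparam] at h4
    rw [Polynomial.eval_add, Polynomial.eval_comp]
    push_cast
    rw [mul_add]
    refine add_le_add (h6.trans ?_) (h4.trans ?_)
    · exact le_mul_of_one_le_left (Nat.cast_nonneg _) h7
    · gcongr

/-! ## Polynomial-time functions on lists and numbers -/

section Lists
variable {α β γ σ : Type} [Enc α] [Enc β] [Enc γ] [Enc σ]

/-- A nonempty list and the pair of its head and tail have the same encoding, so after the test the
branch program runs on the data as they are. -/
theorem PolyTime.listCases {l : α → List β} {g : α → γ} {h : β × List β → α → γ}
    (hl : PolyTime l) (hg : PolyTime g) (hh : PolyTime fun x : (β × List β) × α => h x.1 x.2) :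
    PolyTime fun a => (match l a with | [] => g a | b :: t => h (b, t) a : γ) := by
  have key : PolyTime fun x : List β × α =>
      (match x.1 with | [] => g x.2 | b :: t => h (b, t) x.2 : γ) := by
    obtain ⟨c, N₁, q, H⟩ := hh
    obtain ⟨c', N₂, q', H'⟩ := hg.comp (PolyTime.snd (α := List β))
    refine ⟨.cond (.hd (.var 0)) c c', max N₁ N₂, q + q' + Polynomial.C 3, fun x => ?_⟩
    obtain ⟨l, a⟩ := x
    simp only [Polynomial.eval_add, Polynomial.eval_C]
    cases l with
    | nil =>
      obtain ⟨⟨t, h1, h2⟩, h3⟩ := H' ([], a)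
      simp only at h1 h2 h3
      refine ⟨⟨2 + 1 + t, fun s h0 hs => ?_, by omega⟩, by simp only; omega⟩
      exact Exec.cond_false (by simp [Exp.value, h0, enc_pair, enc_list_nil, Data.hd])
        (h1.mono (le_max_right _ _) s h0 hs)
    | cons b l =>
      obtain ⟨⟨t, h1, h2⟩, h3⟩ := H ((b, l), a)
      have e : esize ((b, l), a) = esize (b :: l, a) := by simp
      rw [e] at h2 h3
      simp only at h1 h2 h3
      refine ⟨⟨2 + 1 + t, fun s h0 hs => ?_, by omega⟩, by simp only; omega⟩
      exact Exec.cond_true (by simp [Exp.value, h0, enc_pair, enc_list_cons, Data.hd])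
        (h1.mono (le_max_left _ _) s h0 hs)
  exact key.comp (hl.pair PolyTime.id)

theorem PolyTime.cons {f : α → β} {l : α → List β} (hf : PolyTime f) (hl : PolyTime l) :
    PolyTime fun a => f a :: l a :=
  (hf.pair hl).congr_enc fun _ => rfl

theorem PolyTime.isEmpty {l : α → List β} (hl : PolyTime l) : PolyTime fun a => (l a).isEmpty :=
  (PolyTime.listCases (h := fun _ _ => false) hl (.const true) (.const false)).of_eq
    fun a => by cases l a <;> rfl

theorem esize_tail_le (l : List α) : esize l.tail ≤ esize l := by cases l <;> simp; omega

theorem PolyTime.tail {l : α → List β} (hl : PolyTime l) : PolyTime fun a => (l a).tail :=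
  (PolyTime.of_exp (.tl (.var 0)) Polynomial.X (f := fun l : List β => l.tail)
    (fun l s h => by cases l <;> simp [Exp.value, h, enc_list_nil, enc_list_cons, Data.tl])
    (fun l => by simpa using esize_tail_le l)).comp hl

theorem PolyTime.reverse {l : α → List β} (hl : PolyTime l) : PolyTime fun a => (l a).reverse := by
  have h : PolyTime fun l : List β => l.foldl (fun s b => b :: s) [] :=
    PolyTime.foldl (f := fun x : List β × List β × β => x.2.2 :: x.2.1) .id (.const [])
      (.cons (PolyTime.snd.comp .snd) (PolyTime.fst.comp .snd)) (Polynomial.X + 1)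
      fun x s b => by simp; omega
  exact (h.of_eq fun l => by simp).comp hl

theorem PolyTime.map {l : α → List β} {g : α → β → γ} (hl : PolyTime l)
    (hg : PolyTime fun x : α × β => g x.1 x.2) : PolyTime fun a => (l a).map (g a) := by
  obtain ⟨c, N, q, H⟩ := _root_.id hg
  have h : PolyTime fun a => (l a).foldl (fun s b => g a b :: s) [] :=
    PolyTime.foldl (f := fun x : α × List γ × β => g x.1 x.2.2 :: x.2.1) hl (.const [])
      (.cons (hg.comp (PolyTime.fst.pair (PolyTime.snd.comp .snd))) (PolyTime.fst.comp .snd))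
      (q.comp (Polynomial.X + 1) + 1)
      fun x s b => by
        have := (H (x, b)).2
        simp at this ⊢; omega
  refine (h.of_eq (g := fun a => (l a).foldl (fun s b => g a b :: s) []) fun a => rfl).reverse.of_eq
    fun a => ?_
  have : ∀ (l : List β) (acc : List γ), (l.foldl (fun s b => g a b :: s) acc) =
      (l.map (g a)).reverse ++ acc := by
    intro l
    induction l with
    | nil => simp
    | cons b l ih => intro acc; simp [ih]
  simp [this]

theorem PolyTime.append {l l' : α → List β} (hl : PolyTime l) (hl' : PolyTime l') :
    PolyTime fun a => l a ++ l' a := by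
  have h : PolyTime fun a => (l a).reverse.foldl (fun s b => b :: s) (l' a) :=
    PolyTime.foldl (f := fun x : α × List β × β => x.2.2 :: x.2.1) hl.reverse hl'
      (.cons (PolyTime.snd.comp .snd) (PolyTime.fst.comp .snd)) (Polynomial.X + 1)
      fun x s b => by simp; omega
  exact h.of_eq fun a => by simp

theorem esize_append (l l' : List α) : esize (l ++ l') + 1 = esize l + esize l' := by
  induction l with
  | nil => simp; omega
  | cons a l ih => simp only [List.cons_append, esize_cons]; omega

theorem PolyTime.flatMap {l : α → List β} {g : α → β → List γ} (hl : PolyTime l)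
    (hg : PolyTime fun x : α × β => g x.1 x.2) : PolyTime fun a => (l a).flatMap (g a) := by
  obtain ⟨c, N, q, H⟩ := _root_.id hg
  have h : PolyTime fun a => (l a).foldl (fun s b => s ++ g a b) [] :=
    PolyTime.foldl (f := fun x : α × List γ × β => x.2.1 ++ g x.1 x.2.2) hl (.const [])
      (.append (PolyTime.fst.comp .snd) (hg.comp (PolyTime.fst.pair (PolyTime.snd.comp .snd))))
      (q.comp (Polynomial.X + 1))
      fun x s b => by
        have := (H (x, b)).2
        have := esize_append s (g x b)
        simp at *; omega
  refine h.of_eq fun a => ?_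
  have : ∀ (l : List β) (acc : List γ), (l.foldl (fun s b => s ++ g a b) acc) =
      acc ++ l.flatMap (g a) := by
    intro l
    induction l with
    | nil => simp
    | cons b l ih => intro acc; simp [ih]
  simp [this]

theorem PolyTime.and {b b' : α → Bool} (hb : PolyTime b) (hb' : PolyTime b') :
    PolyTime fun a => b a && b' a :=
  (PolyTime.ite hb hb' (.const false)).of_eq fun a => by cases b a <;> rfl

/-- Functions of the first `k` members of a list over a finite alphabet. -/
theorem PolyTime.table (k : ℕ) : ∀ F : List (Bool × Bool) → β,
    PolyTime fun l : List (Bool × Bool) => F (l.take k) := by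
  induction k with
  | zero => intro F; simpa using PolyTime.const (F [])
  | succ k ih =>
    intro F
    have hx : PolyTime fun x : ((Bool × Bool) × List (Bool × Bool)) × List (Bool × Bool) =>
        x.1.1 := PolyTime.fst.comp .fst
    have hr : ∀ v : Bool × Bool, PolyTime
        fun x : ((Bool × Bool) × List (Bool × Bool)) × List (Bool × Bool) =>
          F (v :: x.1.2.take k) := fun v =>
      (ih fun t => F (v :: t)).comp (PolyTime.snd.comp (PolyTime.fst (β := List (Bool × Bool))))
    -- Branching on the two bits of the head leaves one of four functions of the tail; the whole
    -- table of `F` is thus built into the program.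
    refine (PolyTime.listCases (α := List (Bool × Bool)) (β := Bool × Bool)
      (h := fun (x : (Bool × Bool) × List (Bool × Bool)) (_ : List (Bool × Bool)) =>
      if x.1.1 = true then (if x.1.2 = true then F ((true, true) :: x.2.take k)
        else F ((true, false) :: x.2.take k)) else
        (if x.1.2 = true then F ((false, true) :: x.2.take k)
        else F ((false, false) :: x.2.take k))) .id (.const (F []))
      (.ite (PolyTime.fst.comp hx) (.ite (PolyTime.snd.comp hx) (hr _) (hr _))
        (.ite (PolyTime.snd.comp hx) (hr _) (hr _)))).of_eq fun l => ?_
    rcases l with _ | ⟨⟨_ | _, _ | _⟩, l⟩ <;> simp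

end Lists

/-! ### Unary numbers -/

/-- A natural number that is encoded in unary. -/
structure Unary where
  /-- The number. -/
  val : ℕ

instance : Enc Unary := ⟨fun n => encUnary n.val⟩

section Unary
variable {α β : Type} [Enc α] [Enc β]

theorem PolyTime.unaryLength {l : α → List β} (hl : PolyTime l) :
    PolyTime fun a => Unary.mk (l a).length := by
  refine (PolyTime.map (g := fun _ _ => ()) hl (.const ())).congr_enc fun a => ?_
  simp only [enc, encUnary, List.map_const', List.map_replicate]

theorem PolyTime.unaryToList {u : α → Unary} (hu : PolyTime u) :
    PolyTime fun a => List.replicate (u a).val () :=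
  hu.congr_enc fun a => by simp [enc, encUnary]

theorem PolyTime.unarySub {u v : α → Unary} (hu : PolyTime u) (hv : PolyTime v) :
    PolyTime fun a => Unary.mk ((u a).val - (v a).val) := by
  refine (PolyTime.unaryLength (PolyTime.foldl (f := fun x : α × List Unit × Unit => x.2.1.tail)
    hv.unaryToList hu.unaryToList (.tail (PolyTime.fst.comp .snd)) 0
    fun x s b => by simpa using esize_tail_le s)).of_eq fun a => ?_
  have : ∀ (m : ℕ) (l : List Unit),
      ((List.replicate m ()).foldl (fun s _ => s.tail) l) = l.drop m := by
    intro m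
    induction m with
    | zero => simp
    | succ m ih => intro l; simp [List.replicate_succ, ih]
  simp [this]

theorem PolyTime.unaryEq {u v : α → Unary} (hu : PolyTime u) (hv : PolyTime v) :
    PolyTime fun a => decide ((u a).val = (v a).val) := by
  refine ((hu.unarySub hv).unaryToList.isEmpty.and
    (hv.unarySub hu).unaryToList.isEmpty).of_eq fun a => ?_
  rw [Bool.eq_iff_iff]
  simp only [decide_eq_true_eq, Bool.and_eq_true, List.isEmpty_iff, List.replicate_eq_nil_iff]
  omega

/-- The list is built from its end: when `s` has been collected, the next member is `n - 1 -
s.length`, so `m` steps give the last `m` members. -/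
theorem PolyTime.range {u : α → Unary} (hu : PolyTime u) :
    PolyTime fun a => (List.range (u a).val).map Unary.mk := by
  have h : PolyTime fun u : Unary => (List.replicate u.val ()).foldl
      (fun (s : List Unary) _ => Unary.mk (u.val - 1 - s.length) :: s) [] :=
    PolyTime.foldl (f := fun x : Unary × List Unary × Unit =>
        Unary.mk (x.1.val - 1 - x.2.1.length) :: x.2.1) (PolyTime.unaryToList .id) (.const [])
      (.cons (PolyTime.unarySub (α := Unary × List Unary × Unit)
        (u := fun x => Unary.mk (x.1.val - 1)) (v := fun x => Unary.mk x.2.1.length)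
        (PolyTime.unarySub (v := fun _ => Unary.mk 1) .fst (.const _))
        (PolyTime.unaryLength (PolyTime.fst.comp .snd))) (PolyTime.fst.comp .snd))
      (Polynomial.X + 1) fun x s b => by
        have h1 : ∀ m n : ℕ, m ≤ n → esize (Unary.mk m) ≤ esize (Unary.mk n) := by
          have h2 : ∀ m, esize (Unary.mk m) = 2 * m + 1 := by
            intro m
            induction m with
            | zero => rfl
            | succ m ih =>
              have : esize (Unary.mk (m + 1)) = esize (Unary.mk m) + 2 := by
                simp [esize, enc, encUnary, List.replicate_succ, encList, Data.size]; omega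
              omega
          intro m n h
          simp only [h2]; omega
        have : esize (Unary.mk (x.val - 1 - s.length)) ≤ esize x := h1 _ x.val (by omega)
        simp at this ⊢; omega
  refine (h.of_eq (g := fun u => (List.replicate u.val ()).foldl
      (fun (s : List Unary) _ => Unary.mk (u.val - 1 - s.length) :: s) []) fun _ => rfl).comp
        hu |>.of_eq fun a => ?_
  generalize (u a).val = n
  have key : ∀ m, m ≤ n → (List.replicate m ()).foldl
      (fun (s : List Unary) _ => Unary.mk (n - 1 - s.length) :: s) [] =
        ((List.range n).map Unary.mk).drop (n - m) := by
    intro m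
    induction m with
    | zero => intro _; simp
    | succ m ih =>
      intro hm
      rw [List.replicate_succ', List.foldl_append, ih (by omega)]
      have h3 : n - (m + 1) < ((List.range n).map Unary.mk).length := by simp; omega
      rw [List.drop_eq_getElem_cons h3]
      have h4 : n - (m + 1) + 1 = n - m := by omega
      have h5 : n - 1 - (n - (n - m)) = n - (m + 1) := by omega
      simp [h4, h5]
  simpa using (key n le_rfl).symm

end Unary

/-! ### Binary numbers -/

section Binary
variable {α β : Type} [Enc α] [Enc β]

theorem enc_nat (n : ℕ) : enc n = enc n.bits := rfl

theorem esize_nat (n : ℕ) : esize n = esize n.bits := rfl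

theorem PolyTime.bits {f : α → ℕ} (hf : PolyTime f) : PolyTime fun a => (f a).bits :=
  hf.congr_enc fun _ => (enc_nat _).symm

theorem esize_bit_le (b : Bool) (n : ℕ) : esize (Nat.bit b n) ≤ esize n + 4 := by
  simp only [esize_nat]
  by_cases h : n = 0 → b = true
  · rw [Nat.bits_append_bit n b h, esize_cons]
    have := esize_bool_le b
    omega
  · push Not at h
    obtain ⟨rfl, h⟩ := h
    rw [Bool.eq_false_iff.2 h]
    simp

theorem bits_isEmpty (n : ℕ) : n.bits.isEmpty = decide (n = 0) := by
  rcases Nat.eq_zero_or_pos n with rfl | h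
  · simp
  · rw [decide_eq_false h.ne']
    rw [← Nat.bit_bodd_div2 n]
    rw [Nat.bits_append_bit]
    · rfl
    · intro h2
      by_contra h3
      have := Nat.bit_bodd_div2 n
      rw [h2, Bool.eq_false_iff.2 h3] at this
      simp at this
      omega

theorem PolyTime.isZero {f : α → ℕ} (hf : PolyTime f) : PolyTime fun a => decide (f a = 0) :=
  hf.bits.isEmpty.of_eq fun _ => (bits_isEmpty _).symm

/-- Appending a zero bit to `0` must give the empty bit list again, which is why this case is
separated. -/
theorem PolyTime.bit {b : α → Bool} {f : α → ℕ} (hb : PolyTime b) (hf : PolyTime f) :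
    PolyTime fun a => Nat.bit (b a) (f a) := by
  refine (PolyTime.ite (hb.ite (.const false) hf.isZero) (.const []) (hb.cons hf.bits)).congr_enc
    fun a => ?_
  rw [enc_nat]
  congr 1
  by_cases hb : b a = true
  · simp [hb]
  · rw [Bool.eq_false_iff.2 hb]
    by_cases hf : f a = 0
    · simp [hf]
    · simp [hf]

theorem PolyTime.shift {f : α → ℕ} {u : α → Unary} (hf : PolyTime f) (hu : PolyTime u) :
    PolyTime fun a => f a * 2 ^ (u a).val := by
  refine (PolyTime.foldl (f := fun x : α × ℕ × Unit => Nat.bit false x.2.1) hu.unaryToList hf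
    (.bit (.const false) (PolyTime.fst.comp .snd)) 4 fun x s b => ?_).of_eq fun a => ?_
  · have h4 : (4 : Polynomial ℕ) = Polynomial.C 4 := rfl
    rw [h4, Polynomial.eval_C]
    exact esize_bit_le _ _
  · generalize (u a).val = n
    induction n with
    | zero => simp
    | succ n ih =>
      rw [List.replicate_succ', List.foldl_append, ← ih]
      simp [Nat.bit_val]; ring

/-- The number with a given sign and absolute value. -/
def signed (b : Bool) (n : ℕ) : ℤ := if b = true then -(n : ℤ) else n

/-- The encoding gives zero the sign bit `false`, whatever `b` is. -/
theorem PolyTime.signed {b : α → Bool} {f : α → ℕ} (hb : PolyTime b) (hf : PolyTime f) :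
    PolyTime fun a => FineGrained.signed (b a) (f a) := by
  refine ((PolyTime.ite hf.isZero (.const false) hb).pair hf).congr_enc fun a => ?_
  have h1 : (FineGrained.signed (b a) (f a)).natAbs = f a := by
    unfold FineGrained.signed; split_ifs <;> simp
  have h2 : decide (FineGrained.signed (b a) (f a) < 0) =
      (if decide (f a = 0) = true then false else b a) := by
    unfold FineGrained.signed
    cases b a <;> by_cases h : f a = 0 <;> simp [h]
    omega
  simp only [enc, encInt, h1, h2]

theorem PolyTime.natAbs {f : α → ℤ} (hf : PolyTime f) : PolyTime fun a => (f a).natAbs :=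
  (PolyTime.of_exp (.tl (.var 0)) Polynomial.X (f := Int.natAbs)
    (fun z s h => by simp [Exp.value, h, enc, encInt, Data.tl])
    (fun z => by simp [esize, enc, encInt, Data.size]; omega)).comp hf

theorem PolyTime.isNeg {f : α → ℤ} (hf : PolyTime f) : PolyTime fun a => decide (f a < 0) :=
  (PolyTime.of_exp (.hd (.var 0)) Polynomial.X (f := fun z : ℤ => decide (z < 0))
    (fun z s h => by simp [Exp.value, h, enc, encInt, Data.hd])
    (fun z => by simp [esize, enc, encInt, Data.size]; omega)).comp hf

theorem PolyTime.ratOfInt {f : α → ℤ} (hf : PolyTime f) : PolyTime fun a => (f a : ℚ) :=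
  (hf.pair (.const 1)).congr_enc fun a => by simp [enc, encRat]

theorem PolyTime.intOfNat {f : α → ℕ} (hf : PolyTime f) : PolyTime fun a => (f a : ℤ) :=
  ((PolyTime.const false).signed hf).of_eq fun a => by simp [FineGrained.signed]

end Binary

/-! ## Isolating gadgets -/

/-- A function on the naturals and `-1` that agrees with `|m| ^ p` is polynomial only if `p` is an
even integer. -/
theorem even_of_polynomial {p : ℝ} (R : Polynomial ℝ)
    (hR : ∀ m : ℕ, R.eval (m : ℝ) = (m : ℝ) ^ p) (hR' : R.eval (-1) = 1) : ∃ m : ℤ, p = 2 * m := by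
  -- The identity `R(2X) = 2 ^ p * R(X)` holds at all naturals, hence identically. It forces `2 ^ i
  -- = 2 ^ p` for each exponent `i` of `R`, so `R` is the monomial of degree `p`, and its value at
  -- `-1` gives the parity.
  have h1 : R.comp (Polynomial.C 2 * Polynomial.X) = Polynomial.C ((2 : ℝ) ^ p) * R := by
    refine Polynomial.eq_of_infinite_eval_eq _ _ ?_
    refine (Set.infinite_range_of_injective (Nat.cast_injective (R := ℝ))).mono ?_
    rintro _ ⟨m, rfl⟩
    have := hR (2 * m)
    push_cast at this
    simp [this, hR, Real.mul_rpow]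
  have h2 : ∀ i, R.coeff i ≠ 0 → p = i := by
    intro i hi
    have h3 := congrArg (fun q => Polynomial.coeff q i) h1
    simp only [Polynomial.comp_C_mul_X_coeff, Polynomial.coeff_C_mul] at h3
    rw [mul_comm] at h3
    have h4 := mul_right_cancel₀ hi h3
    rw [← Real.rpow_natCast] at h4
    have := congrArg Real.log h4
    rw [Real.log_rpow (by norm_num), Real.log_rpow (by norm_num)] at this
    exact (mul_right_cancel₀ (Real.log_pos (by norm_num)).ne' this).symm
  have h5 : R.eval 1 = 1 := by simpa using hR 1
  have h6 : R ≠ 0 := by rintro rfl; simp at h5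
  have hd := h2 R.natDegree (by simpa using h6)
  have h7 : R = Polynomial.C (R.coeff R.natDegree) * Polynomial.X ^ R.natDegree := by
    ext i
    rw [Polynomial.coeff_C_mul_X_pow]
    split_ifs with hi
    · rw [hi]
    · by_contra h8
      exact hi (by exact_mod_cast (h2 i h8).symm.trans hd)
  rw [h7] at h5 hR'
  simp only [Polynomial.eval_mul, Polynomial.eval_C, Polynomial.eval_pow, Polynomial.eval_X,
    one_pow, mul_one] at h5 hR'
  rw [h5, one_mul] at hR'
  obtain ⟨m, hm⟩ : Even R.natDegree := by
    by_contra ho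
    rw [Nat.not_even_iff_odd] at ho
    rw [ho.neg_one_pow] at hR'
    norm_num at hR'
  exact ⟨m, by rw [hd]; conv_lhs => rw [hm]
               push_cast; ring⟩

/-- The alternating sum of the values of `f` at the vertices of a cube. -/
def alternatingSum (k : ℕ) (f : ℤ → ℝ) (s : ℤ) : ℝ :=
  ∑ τ : Fin k → ℤˣ, ((∏ i, τ i : ℤˣ) : ℤ) * f (s + ∑ i, (τ i : ℤ))

open fwdDiff in
-- Splitting off the first sign writes the sum as the difference of two smaller ones at `s + 1` and
-- `s - 1`, that is, one forward difference with step `2`.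
theorem alternatingSum_eq_fwdDiff (f : ℤ → ℝ) (k : ℕ) :
    ∀ s : ℤ, alternatingSum k f s = (fwdDiff 2)^[k] f (s - k) := by
  induction k with
  | zero => intro s; simp [alternatingSum]
  | succ k ih =>
    intro s
    rw [Function.iterate_succ_apply', fwdDiff]
    have e1 : s - ((k + 1 : ℕ) : ℤ) + 2 = (s + 1) - k := by push_cast; ring
    have e2 : s - ((k + 1 : ℕ) : ℤ) = (s - 1) - k := by push_cast; ring
    rw [e1, e2, ← ih, ← ih]
    unfold alternatingSum
    rw [← Fintype.sum_equiv (Fin.consEquiv fun _ => ℤˣ) (fun x =>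
      (((x.1 * ∏ i, x.2 i : ℤˣ) : ℤ) : ℝ) * f (s + ((x.1 : ℤ) + ∑ i, (x.2 i : ℤ)))) _
      (fun x => by simp [Fin.consEquiv, Fin.prod_univ_succ, Fin.sum_univ_succ])]
    rw [Fintype.sum_prod_type]
    simp only [UnitsInt.univ]
    rw [Finset.sum_pair (by decide)]
    rw [sub_eq_add_neg, ← Finset.sum_neg_distrib]
    congr 1
    · simp [add_assoc]
    · refine Finset.sum_congr rfl fun x _ => ?_
      simp [sub_eq_add_neg, add_assoc]

/-- If all alternating sums vanish, so does the `k`-th difference with step `2`. The Newton series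
at `-2` then terminates and represents `|m| ^ p` on the even integers from `-2` upwards by a
polynomial, contradicting `even_of_polynomial`. -/
theorem exists_alternatingSum_ne_zero {p : ℝ} (hev : ∀ m : ℤ, p ≠ 2 * (m : ℝ))
    (k : ℕ) : ∃ s : ℤ, alternatingSum k (fun m => |(m : ℝ)| ^ p) s ≠ 0 := by
  by_contra! h
  set f : ℤ → ℝ := fun m => |(m : ℝ)| ^ p with hf
  have h0 : (fwdDiff 2)^[k] f = 0 := by
    funext y
    have := alternatingSum_eq_fwdDiff f k (y + k)
    rw [h, add_sub_cancel_right] at this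
    exact this.symm
  have h1 : ∀ j, k ≤ j → (fwdDiff 2)^[j] f (-2) = 0 := by
    intro j hj
    obtain ⟨i, rfl⟩ := Nat.exists_eq_add_of_le' hj
    rw [Function.iterate_add_apply, h0]
    have : ∀ i, (fwdDiff (2 : ℤ))^[i] (0 : ℤ → ℝ) = 0 := by
      intro i
      induction i with
      | zero => rfl
      | succ i ih => rw [Function.iterate_succ_apply', ih]; funext y; simp [fwdDiff]
    rw [this]; rfl
  have h2 : ∀ n : ℕ, f (-2 + n • 2) =
      ∑ j ∈ Finset.range k, (n.choose j : ℝ) * (fwdDiff 2)^[j] f (-2) := by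
    intro n
    rw [shift_eq_sum_fwdDiff_iter 2 f n (-2)]
    simp only [nsmul_eq_mul]
    -- Both sums are extended to a common range: the differences vanish from `k` on, the binomial
    -- coefficients beyond `n`.
    rw [Finset.sum_subset (Finset.range_mono (le_max_left (n + 1) k)),
      Finset.sum_subset (Finset.range_mono (le_max_right (n + 1) k))]
    · intro j _ hj
      rw [h1 j (by simpa using hj), mul_zero]
    · intro j _ hj
      rw [Nat.choose_eq_zero_of_lt (by simpa using hj), Nat.cast_zero, zero_mul]
  let Q : Polynomial ℝ := ∑ j ∈ Finset.range k,
    Polynomial.C ((fwdDiff 2)^[j] f (-2) / (j.factorial : ℝ)) * descPochhammer ℝ j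
  have h3 : ∀ n : ℕ, Q.eval (n : ℝ) = f (-2 + n • 2) := by
    intro n
    rw [h2, Polynomial.eval_finsetSum]
    refine Finset.sum_congr rfl fun j _ => ?_
    rw [Polynomial.eval_mul, Polynomial.eval_C, descPochhammer_eval_eq_descFactorial,
      Nat.descFactorial_eq_factorial_mul_choose]
    have := Nat.factorial_ne_zero j
    push_cast
    field_simp
  -- Shifting by one and dividing by `2 ^ p` turns the points `-2, 0, 2, 4, …` into `-1, 0, 1, 2,
  -- …`, exactly the points that `even_of_polynomial` needs.
  obtain ⟨m, hm⟩ := even_of_polynomial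
    (Polynomial.C ((2 : ℝ) ^ p)⁻¹ * Q.comp (Polynomial.X + 1)) (fun m => by
      have := h3 (m + 1)
      have e : (-2 + (m + 1) • 2 : ℤ) = 2 * m := by simp; ring
      rw [e, hf] at this
      push_cast at this
      simp only [Polynomial.eval_mul, Polynomial.eval_C, Polynomial.eval_comp, Polynomial.eval_add,
        Polynomial.eval_X, Polynomial.eval_one, this]
      rw [abs_mul, abs_two, Nat.abs_cast, Real.mul_rpow (by norm_num) (by positivity)]
      field_simp) (by
      have := h3 0
      rw [hf] at this
      simp only [Nat.cast_zero, zero_smul, add_zero] at this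
      have h2p : (2 : ℝ) ^ p ≠ 0 := by positivity
      simp [this, h2p])
  exact hev m hm

/-- Rows of integers whose sum of `p`-th powers tells whether all of `k` signs are `-1`. -/
theorem exists_gadget {p : ℝ} (hev : ∀ m : ℤ, p ≠ 2 * (m : ℝ)) (k : ℕ) :
    ∃ (G : List ((Fin k → ℤ) × ℤ)) (A D : ℝ), 0 ≤ A ∧ 0 < D ∧ ∀ x : Fin k → ℤˣ,
      (G.map fun g => |((∑ i, g.1 i * (x i : ℤ) + g.2 : ℤ) : ℝ)| ^ p).sum =
        if ∀ i, x i = -1 then A + D else A := by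
  classical
  obtain ⟨s, hs⟩ := exists_alternatingSum_ne_zero hev k
  set f : ℤ → ℝ := fun m => |(m : ℝ)| ^ p with hf
  -- Only nonnegative multiplicities of rows are available, so the sign of the alternating sum is
  -- moved into the choice of the sign vectors.
  obtain ⟨ε, hε⟩ : ∃ ε : ℤˣ, 0 < ((ε : ℤ) : ℝ) * alternatingSum k f s := by
    rcases lt_or_gt_of_ne hs with h | h
    · exact ⟨-1, by simpa using h⟩
    · exact ⟨1, by simpa using h⟩
  let y : (Fin k → Bool) → (Fin k → ℤˣ) → Fin k → ℤˣ := fun S x i => if S i then x i else 1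
  -- For each subset `S` of the variables, half of the sign vectors `τ` are kept, selected by the
  -- parity of `τ` against that of `S`. The row has coefficients `τ i` on `S`, while the other `τ i`
  -- enter its constant.
  let I : Finset ((Fin k → Bool) × (Fin k → ℤˣ)) :=
    Finset.univ.filter fun a => ∏ i, a.2 i = ε * ∏ i, y a.1 (fun _ => -1) i
  let row : (Fin k → Bool) × (Fin k → ℤˣ) → (Fin k → ℤ) × ℤ := fun a =>
    (fun i => if a.1 i then (a.2 i : ℤ) else 0, s + ∑ i, if a.1 i then 0 else (a.2 i : ℤ))
  set C : ℝ := ∑ τ : Fin k → ℤˣ, f (s + ∑ i, (τ i : ℤ)) with hC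
  set D : ℝ := ((ε : ℤ) : ℝ) * alternatingSum k f s with hD
  have hrow : ∀ a x, ∑ i, (row a).1 i * (x i : ℤ) + (row a).2 =
      s + ∑ i, ((a.2 i * y a.1 x i : ℤˣ) : ℤ) := by
    intro a x
    simp only [row, y]
    rw [add_left_comm, ← Finset.sum_add_distrib]
    congr 1
    refine Finset.sum_congr rfl fun i _ => ?_
    split_ifs <;> simp
  have hsum : ∀ x : Fin k → ℤˣ, ∑ a ∈ I, f (s + ∑ i, ((a.2 i * y a.1 x i : ℤˣ) : ℤ)) =
      2 ^ k * C / 2 + if ∀ i, x i = -1 then 2 ^ k * D / 2 else 0 := by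
    intro x
    -- The indicator of the parity condition is half of one plus a character of `τ`. Substituting `τ
    -- * y S x` for `τ` leaves the plain sum unchanged and multiplies the alternating sum by the
    -- product of the `x i` over `S`.
    have h1 : ∀ S : Fin k → Bool, ∑ τ : Fin k → ℤˣ, (if ∏ i, τ i = ε * ∏ i, y S (fun _ => -1) i
        then f (s + ∑ i, ((τ i * y S x i : ℤˣ) : ℤ)) else 0) =
        C / 2 + D / 2 * ∏ i, (if S i then (-((x i : ℤ) : ℝ)) else 1) := by
      intro S
      have h2 : ∏ i, (if S i then (-((x i : ℤ) : ℝ)) else 1) =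
          (((∏ i, y S (fun _ => -1) i) * ∏ i, y S x i : ℤˣ) : ℤ) := by
        rw [← Finset.prod_mul_distrib]
        push_cast [Units.coe_prod]
        refine Finset.prod_congr rfl fun i _ => ?_
        simp only [y]; split_ifs <;> simp
      rw [h2]
      generalize ∏ i, y S (fun _ => -1) i = e
      have h3 : ∀ u v : ℤˣ, ∀ r : ℝ, (if u = v then r else 0) =
          r / 2 + ((v : ℤ) : ℝ) * (((u : ℤ) : ℝ) * r) / 2 := by
        intro u v r
        rcases Int.units_eq_one_or u with rfl | rfl <;>
          rcases Int.units_eq_one_or v with rfl | rfl <;>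
          norm_num [show (1 : ℤˣ) ≠ -1 by decide, show (-1 : ℤˣ) ≠ 1 by decide] <;> ring
      simp only [h3]
      rw [Finset.sum_add_distrib, ← Finset.sum_div, ← Finset.sum_div, ← Finset.mul_sum]
      have h4 : ∑ τ : Fin k → ℤˣ, f (s + ∑ i, ((τ i * y S x i : ℤˣ) : ℤ)) = C := by
        rw [hC]
        exact Fintype.sum_equiv (Equiv.mulRight (y S x)) _ _ fun τ => rfl
      have h5 : ∑ τ : Fin k → ℤˣ, (((∏ i, τ i : ℤˣ) : ℤ) : ℝ) *
          f (s + ∑ i, ((τ i * y S x i : ℤˣ) : ℤ)) =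
            (((∏ i, y S x i : ℤˣ) : ℤ) : ℝ) * alternatingSum k f s := by
        rw [alternatingSum, Finset.mul_sum]
        refine Fintype.sum_equiv (Equiv.mulRight (y S x)) _ _ fun τ => ?_
        have h6 : (∏ i, y S x i) * (∏ i, y S x i) = 1 := Int.units_mul_self _
        have h7 : ∏ i, (Equiv.mulRight (y S x)) τ i = (∏ i, τ i) * ∏ i, y S x i := by
          simp [Finset.prod_mul_distrib]
        rw [h7, ← mul_assoc]
        congr 1
        rw [← Int.cast_mul, ← Units.val_mul, mul_comm (∏ i, τ i), ← mul_assoc, h6, one_mul]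
      rw [h4, h5, hD]
      push_cast
      ring
    -- Summing over all subsets gives `∏ i, (1 - x i)`, which isolates the single point where all
    -- signs are `-1`.
    have h8 : ∑ S : Fin k → Bool, ∏ i, (if S i then (-((x i : ℤ) : ℝ)) else 1) =
        if ∀ i, x i = -1 then (2 : ℝ) ^ k else 0 := by
      rw [← Fintype.piFinset_univ, ← Finset.prod_univ_sum (fun _ => Finset.univ)
        (fun i (b : Bool) => if b then (-((x i : ℤ) : ℝ)) else 1)]
      simp only [Fintype.sum_bool, if_true, Bool.false_eq_true, if_false]
      split_ifs with hx
      · simp [hx]; norm_num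
      · push Not at hx
        obtain ⟨i, hi⟩ := hx
        refine Finset.prod_eq_zero (Finset.mem_univ i) ?_
        rcases Int.units_eq_one_or (x i) with h | h
        · simp [h]
        · exact absurd h hi
    rw [Finset.sum_filter, ← Finset.univ_product_univ, Finset.sum_product]
    simp only [h1]
    rw [Finset.sum_add_distrib, ← Finset.mul_sum, h8]
    simp
    split_ifs <;> ring
  refine ⟨I.toList.map row, 2 ^ k * C / 2, 2 ^ k * D / 2, ?_, by positivity, fun x => ?_⟩
  · have : 0 ≤ C := Finset.sum_nonneg fun τ _ => by positivity
    positivity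
  · rw [List.map_map, Finset.sum_map_toList]
    refine (Finset.sum_congr rfl fun a _ => ?_).trans ((hsum x).trans ?_)
    · simp only [Function.comp, hrow, hf]
    · split_ifs <;> simp

/-! ## Norms of lists -/

/-- The `ℓ_p` norm of a list of real numbers. -/
noncomputable def listNorm (p : ℝ) (l : List ℝ) : ℝ := (l.map fun x => |x| ^ p).sum ^ (1 / p)

section Norm
variable {p : ℝ}

theorem lpNorm_eq (hp : 1 ≤ p) {d : ℕ} (v : Fin d → ℝ) :
    lpNorm p v = (∑ i, |v i| ^ p) ^ (1 / p) := by
  have h : (ENNReal.ofReal p).toReal = p := ENNReal.toReal_ofReal (by linarith)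
  rw [lpNorm, PiLp.norm_eq_sum (by rw [h]; linarith), h]
  rfl

theorem listNorm_ofFn (hp : 1 ≤ p) {d : ℕ} (v : Fin d → ℝ) :
    listNorm p (List.ofFn v) = lpNorm p v := by
  rw [lpNorm_eq hp, listNorm, List.map_ofFn, List.sum_ofFn]
  rfl

theorem lpNorm_le_sum (hp : 1 ≤ p) {d : ℕ} (v : Fin d → ℝ) : lpNorm p v ≤ ∑ i, |v i| := by
  have : Fact (1 ≤ ENNReal.ofReal p) := ⟨by simpa using ENNReal.ofReal_le_ofReal hp⟩
  have h : WithLp.toLp (ENNReal.ofReal p) v =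
      ∑ i, WithLp.toLp (ENNReal.ofReal p) (Pi.single i (v i)) := by
    rw [← WithLp.toLp_sum, Finset.univ_sum_single]
  rw [lpNorm, h]
  refine (norm_sum_le _ _).trans (Finset.sum_le_sum fun i _ => ?_)
  exact (PiLp.norm_single (ENNReal.ofReal p) (fun _ : Fin d => ℝ) i (v i)).le

theorem lpNorm_le_add_sum (hp : 1 ≤ p) {d : ℕ} (v w : Fin d → ℝ) :
    lpNorm p v ≤ lpNorm p w + ∑ i, |v i - w i| := by
  have : Fact (1 ≤ ENNReal.ofReal p) := ⟨by simpa using ENNReal.ofReal_le_ofReal hp⟩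
  refine le_trans ?_ (add_le_add_right (lpNorm_le_sum hp (v - w)) _)
  unfold lpNorm
  refine (norm_add_le (WithLp.toLp _ w) (WithLp.toLp _ (v - w))).trans' (le_of_eq ?_)
  rw [← WithLp.toLp_add, add_sub_cancel]

theorem listNorm_nonneg (l : List ℝ) : 0 ≤ listNorm p l := by
  refine Real.rpow_nonneg (List.sum_nonneg fun x hx => ?_) _
  obtain ⟨y, -, rfl⟩ := List.mem_map.1 hx
  positivity

theorem sum_abs_rpow_nonneg (l : List ℝ) : 0 ≤ (l.map fun x => |x| ^ p).sum := by
  refine List.sum_nonneg fun x hx => ?_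
  obtain ⟨y, -, rfl⟩ := List.mem_map.1 hx
  positivity

theorem listNorm_le_sum (hp : 1 ≤ p) (l : List ℝ) : listNorm p l ≤ (l.map fun x => |x|).sum := by
  have h := listNorm_ofFn hp l.get
  rw [List.ofFn_get] at h
  rw [h]
  refine (lpNorm_le_sum hp _).trans (le_of_eq ?_)
  conv_rhs => rw [← List.ofFn_get l, List.map_ofFn, List.sum_ofFn]
  rfl

/-- Two lists whose members differ by at most `e`. -/
theorem listNorm_le_add_mul (hp : 1 ≤ p) {e : ℝ} {l l' : List ℝ}
    (h : List.Forall₂ (fun x y => |x - y| ≤ e) l l') :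
    listNorm p l ≤ listNorm p l' + l.length * e := by
  have hl := h.length_eq
  have h1 := listNorm_ofFn hp l.get
  have h2 := listNorm_ofFn hp fun i : Fin l.length => l'.get (i.cast hl)
  rw [List.ofFn_get] at h1
  have h3 : List.ofFn (fun i : Fin l.length => l'.get (i.cast hl)) = l' := by
    refine List.ext_get (by simp [hl]) fun i _ _ => by simp
  rw [h3] at h2
  rw [h1, h2]
  refine (lpNorm_le_add_sum hp _ _).trans (add_le_add_right ?_ _)
  refine (Finset.sum_le_card_nsmul Finset.univ _ e fun i _ => ?_).trans (by simp)
  exact List.Forall₂.get h i.2 (hl ▸ i.2)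

/-- The largest natural number less than the norm of a list, or `0`. -/
noncomputable def normFloor (p : ℝ) (l : List ℕ) : ℕ :=
  ⌈listNorm p (l.map fun n : ℕ => (n : ℝ))⌉₊ - 1

/-- A closest-vector query answers whether the norm is at most `c`. Taking the largest natural
number strictly below the norm makes a negative answer say `c ≤ normFloor p l`, the comparison used
in binary search. -/
theorem lt_listNorm_iff {l : List ℕ} {c : ℕ} (hc : c ≠ 0) :
    (c : ℝ) < listNorm p (l.map fun n : ℕ => (n : ℝ)) ↔ c ≤ normFloor p l := by
  rw [← Nat.lt_ceil, normFloor]; omega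

theorem normFloor_le (l : List ℕ) : (normFloor p l : ℝ) ≤ listNorm p (l.map fun n : ℕ => (n : ℝ)) := by
  by_cases h : normFloor p l = 0
  · rw [h]; simpa using listNorm_nonneg _
  · exact ((lt_listNorm_iff h).2 le_rfl).le

theorem le_normFloor_add_one (l : List ℕ) :
    listNorm p (l.map fun n : ℕ => (n : ℝ)) ≤ normFloor p l + 1 := by
  have h := Nat.le_ceil (listNorm p (l.map fun n : ℕ => (n : ℝ)))
  refine h.trans ?_
  rw [normFloor]
  norm_cast
  omega

theorem normFloor_le_sum (hp : 1 ≤ p) (l : List ℕ) : normFloor p l ≤ l.sum := by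
  have h := (normFloor_le (p := p) l).trans (listNorm_le_sum hp _)
  rw [List.map_map] at h
  have : (l.map ((fun x : ℝ => |x|) ∘ fun n : ℕ => (n : ℝ))).sum = (l.sum : ℕ) := by
    rw [Nat.cast_list_sum]
    simp [Function.comp_def]
  rw [this] at h
  exact_mod_cast h

end Norm

/-- Binary search for a number `ρ < 2 ^ B`. -/
theorem foldl_bit_search (ρ B : ℕ) : ∀ h, h = ρ / 2 ^ B →
    (List.range B).reverse.foldl (fun h j => Nat.bit (decide ((2 * h + 1) * 2 ^ j ≤ ρ)) h) h = ρ := by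
  induction B with
  | zero => intro h hh; simpa using hh
  | succ B ih =>
    intro h hh
    rw [List.range_succ, List.reverse_append, List.reverse_singleton, List.singleton_append,
      List.foldl_cons]
    apply ih
    have h1 : (2 * h + 1) * 2 ^ B ≤ ρ ↔ 2 * h + 1 ≤ ρ / 2 ^ B :=
      (Nat.le_div_iff_mul_le (by positivity)).symm
    rw [pow_succ, ← Nat.div_div_eq_div_mul] at hh
    rw [Nat.bit_val]
    by_cases h2 : 2 * h + 1 ≤ ρ / 2 ^ B
    · simp only [h1, h2, decide_true, Bool.toNat_true]; omega
    · simp only [h1, h2, decide_false, Bool.toNat_false]; omega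

/-! ### Computing norms with the lattice algorithm in rank zero. -/

/-- The encoding of an instance is the same for every `p`; the exponent `1` is a dummy. -/
instance : Enc CVPInstance := ⟨(CVP 1).encode⟩

instance {α : Type} [Enc α] (P : α → Prop) : Enc {a // P a} := ⟨fun a => enc a.1⟩

/-- Lattices of rank `0` are easy. -/
theorem PolyTime.cvp_rank_zero {p δ : ℝ} (h : (CVP p).SolvableInTimeTwoPow δ)
    (b : {I : CVPInstance // I.n = 0} → Bool) (hb : ∀ I, b I = true ↔ (CVP p).Yes I.1) :
    PolyTime b := by
  obtain ⟨c, q, H⟩ := h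
  refine PolyTime.of_outputs c q (Polynomial.C 3) (fun I => ?_) fun I => by
    simpa using esize_bool_le _
  obtain ⟨b', t, h1, h2, h3⟩ := H I.1
  have e : b' = b I := by rw [Bool.eq_iff_iff, h2, hb]
  refine ⟨t, e ▸ h1, ?_⟩
  have h0 : (CVP p).param I.1 = 0 := I.2
  -- With rank `0` the factor `2 ^ (δ * n)` equals `1`, so only the polynomial factor remains.
  rw [h0] at h3
  simp only [Nat.cast_zero, mul_zero, Real.rpow_zero, one_mul] at h3
  exact_mod_cast h3

/-- The instance without lattice vectors that compares the norm of `l` with a number. -/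
def normInstance (l : List ℕ) (r : ℕ) (hr : 0 < r) : CVPInstance where
  d := l.length
  n := 0
  B := 0
  t i := (l.get i : ℚ)
  r := r
  linearIndependent := linearIndependent_empty_type
  r_pos := by exact_mod_cast hr

theorem encMatrix_zero {d : ℕ} (B : Matrix (Fin d) (Fin 0) ℚ) : encMatrix B = Data.nil := rfl

theorem encVec_get {α : Type} (l : List α) (f : α → ℚ) :
    encVec (fun i => f (l.get i)) = enc (l.map f) := by
  simp only [encVec, enc]
  congr 1
  conv_rhs => rw [← List.ofFn_get l, List.map_ofFn, List.map_ofFn]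
  rfl

theorem latticeOf_rank_zero {d : ℕ} (B : Matrix (Fin d) (Fin 0) ℝ) : latticeOf B = {0} := by
  ext x
  constructor
  · rintro ⟨z, rfl⟩
    funext i
    exact Fintype.sum_empty fun j => B i j * (z j : ℝ)
  · rintro rfl
    exact ⟨fun i => i.elim0, funext fun i => Fintype.sum_empty fun j : Fin 0 => B i j * ((j.elim0 : ℤ) : ℝ)⟩

theorem normInstance_yes {p : ℝ} (hp : 1 ≤ p) (l : List ℕ) (r : ℕ) (hr : 0 < r) :
    (CVP p).Yes (normInstance l r hr) ↔ listNorm p (l.map fun n : ℕ => (n : ℝ)) ≤ r := by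
  have h1 : latticeOf ((normInstance l r hr).B.map fun q : ℚ => (q : ℝ)) = {0} :=
    latticeOf_rank_zero _
  have h2 : listNorm p (l.map fun n : ℕ => (n : ℝ)) =
      lpNorm p fun i : Fin l.length => ((l.get i : ℕ) : ℝ) := by
    rw [← listNorm_ofFn hp]
    congr 1
    conv_lhs => rw [← List.ofFn_get l, List.map_ofFn]
    rfl
  show lpDist p _ _ ≤ _ ↔ _
  rw [lpDist, h1, Set.image_singleton, csInf_singleton, h2]
  have h3 : lpNorm p (0 - fun i => (((normInstance l r hr).t i : ℚ) : ℝ)) =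
      lpNorm p fun i : Fin l.length => ((l.get i : ℕ) : ℝ) := by
    rw [lpNorm_eq hp, lpNorm_eq hp]
    refine congrArg (· ^ (1 / p)) (Finset.sum_congr rfl fun i _ => ?_)
    show |0 - (((l.get i : ℕ) : ℚ) : ℝ)| ^ p = _
    simp
  rw [h3]
  simp [normInstance]

section Oracle
variable {α : Type} [Enc α] {p δ : ℝ}

/-- The number `(2 * f a + 1) * 2 ^ u` is positive, as a distance bound has to be, and is built by
appending a bit and shifting, without general arithmetic. -/
theorem PolyTime.normLE (hp : 1 ≤ p) (h : (CVP p).SolvableInTimeTwoPow δ) {l : α → List ℕ}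
    {f : α → ℕ} {u : α → Unary} (hl : PolyTime l) (hf : PolyTime f) (hu : PolyTime u) :
    PolyTime fun a => decide ((2 * f a + 1) * 2 ^ (u a).val ≤ normFloor p (l a)) := by
  classical
  have hr : ∀ a, 0 < (2 * f a + 1) * 2 ^ (u a).val := fun a => by positivity
  have h1 : PolyTime fun a => (⟨normInstance (l a) _ (hr a), rfl⟩ :
      {I : CVPInstance // I.n = 0}) := by
    refine (((PolyTime.const ([] : List Unit)).pair ((hl.map (g := fun _ n => (((n : ℕ) : ℤ) : ℚ))
      (PolyTime.ratOfInt (.intOfNat .snd))).pair (PolyTime.intOfNat ((PolyTime.bit (.const true)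
        hf).shift hu)).ratOfInt))).congr_enc fun a => ?_
    rw [enc_pair, enc_pair, enc_list_nil, ← encVec_get]
    simp only [enc, CVP, normInstance, encMatrix_zero, Nat.bit_val]
    simp
  refine (PolyTime.ite ((PolyTime.cvp_rank_zero h (fun I => decide ((CVP p).Yes I.1))
    fun I => decide_eq_true_iff).comp h1) (.const false) (.const true)).of_eq fun a => ?_
  rw [Bool.eq_iff_iff]
  simp only [decide_eq_true_eq, normInstance_yes hp, ← lt_listNorm_iff (hr a).ne']
  split_ifs with h2
  · simpa using h2
  · simpa using h2

theorem sum_lt_two_pow (l : List ℕ) : l.sum < 2 ^ (l.flatMap Nat.bits).length := by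
  induction l with
  | nil => simp
  | cons a l ih =>
    have h1 : a < 2 ^ a.bits.length := by rw [Nat.size_eq_bits_len]; exact Nat.lt_size_self a
    rw [List.flatMap_cons, List.length_append, pow_add, List.sum_cons]
    have h2 := Nat.mul_le_mul (Nat.succ_le_of_lt h1) (Nat.succ_le_of_lt ih)
    simp only [Nat.succ_eq_add_one] at h2
    nlinarith [Nat.zero_le (a * l.sum)]

theorem PolyTime.normFloor (hp : 1 ≤ p) (h : (CVP p).SolvableInTimeTwoPow δ) {l : α → List ℕ}
    (hl : PolyTime l) : PolyTime fun a => FineGrained.normFloor p (l a) := by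
  -- The norm is at most the sum of the entries, so the total number of their bits suffices as the
  -- length of the binary search.
  have hB : PolyTime fun a => Unary.mk ((l a).flatMap Nat.bits).length :=
    (hl.flatMap (g := fun _ n => n.bits) (.bits .snd)).unaryLength
  refine (PolyTime.foldl (s₀ := fun _ => 0) (f := fun x : α × ℕ × Unary =>
    Nat.bit (decide ((2 * x.2.1 + 1) * 2 ^ x.2.2.val ≤ FineGrained.normFloor p (l x.1))) x.2.1)
    hB.range.reverse (.const 0) (.bit (.normLE hp h (hl.comp .fst) (PolyTime.fst.comp .snd)
      (PolyTime.snd.comp .snd)) (PolyTime.fst.comp .snd)) (Polynomial.C 4)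
    fun x s b => by rw [Polynomial.eval_C]; exact esize_bit_le _ _).of_eq fun a => ?_
  rw [← List.map_reverse, List.foldl_map]
  refine (foldl_bit_search _ _ 0 ?_).symm
  rw [Nat.div_eq_of_lt ((normFloor_le_sum hp _).trans_lt (sum_lt_two_pow _))]

/-! ### Approximate multiplication by roots -/

/-- An approximation of `N * w ^ (1 / p)`. -/
noncomputable def rootScale (p : ℝ) (w N : ℕ) : ℕ :=
  w.bits.foldr (fun b h => FineGrained.normFloor p [h, h, if b = true then N else 0]) 0

theorem esize_nat_le {n k : ℕ} (h : n < 2 ^ k) : esize n ≤ 4 * k + 1 := by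
  have h1 : ∀ l : List Bool, esize l ≤ 4 * l.length + 1 := by
    intro l
    induction l with
    | nil => simp
    | cons b l ih => have := esize_bool_le b; simp; omega
  have h2 := h1 n.bits
  rw [Nat.size_eq_bits_len] at h2
  have := Nat.size_le.2 h
  rw [esize_nat]
  omega

/-- One step sends `h` to at most `2 * h + N`; the added `N` makes the bound exactly double. -/
theorem foldl_rootScale_lt (hp : 1 ≤ p) (N : ℕ) (l : List Bool) :
    l.foldr (fun b h => FineGrained.normFloor p [h, h, if b = true then N else 0]) 0 + N ≤
      N * 2 ^ l.length := by
  induction l with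
  | nil => simp
  | cons b l ih =>
    rw [List.foldr_cons, List.length_cons]
    refine (Nat.add_le_add_right (normFloor_le_sum hp _) N).trans ?_
    simp only [List.sum_cons, List.sum_nil]
    split_ifs <;> rw [pow_succ] <;> nlinarith

theorem PolyTime.rootScale (hp : 1 ≤ p) (h : (CVP p).SolvableInTimeTwoPow δ) {w N : α → ℕ}
    (hw : PolyTime w) (hN : PolyTime N) :
    PolyTime fun a => FineGrained.rootScale p (w a) (N a) := by
  -- The growth of the state in one step is not bounded a priori independently of the state; its
  -- size is controlled through its value instead.
  obtain ⟨_, _, q, H⟩ := hw.pair hN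
  refine (PolyTime.foldl_of_bound (s₀ := fun _ => 0) (f := fun x : α × ℕ × Bool =>
    FineGrained.normFloor p [x.2.1, x.2.1, if x.2.2 = true then N x.1 else 0])
    hw.bits.reverse (.const 0) (.normFloor hp h (.cons (PolyTime.fst.comp .snd)
      (.cons (PolyTime.fst.comp .snd) (.cons (.ite (PolyTime.snd.comp .snd) (hN.comp .fst)
        (.const 0)) (.const []))))) (Polynomial.C 4 * q + Polynomial.C 1)
    fun a l' hl' => ?_).of_eq fun a => ?_
  · have h1 := (H a).2
    have h2 := esize_le_of_prefix hl'
    have h3 : esize (w a).bits.reverse = esize (w a).bits := by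
      have : ∀ l l' : List Bool, esize (l.reverse ++ l') + 1 = esize l + esize l' := by
        intro l
        induction l with
        | nil => intro l'; simp; omega
        | cons b l ih => intro l'; simp [ih]; omega
      have h4 := this (w a).bits []
      simp at h4; omega
    have h4 := length_lt_esize l'
    have h5 := length_lt_esize (N a).bits
    rw [esize_pair, esize_nat, esize_nat] at h1
    simp only [Polynomial.eval_add, Polynomial.eval_mul, Polynomial.eval_C]
    refine (esize_nat_le (k := (N a).bits.length + l'.length) ?_).trans (by omega)
    have h6 := foldl_rootScale_lt hp (N a) l'.reverse
    rw [List.foldr_reverse, List.length_reverse] at h6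
    rw [pow_add]
    have h7 : N a < 2 ^ (N a).bits.length := by
      rw [Nat.size_eq_bits_len]; exact Nat.lt_size_self _
    have h8 : 0 < 2 ^ l'.length := by positivity
    have h9 := (Nat.mul_lt_mul_right h8).2 h7
    omega
  · rw [← List.foldr_eq_foldl_reverse, FineGrained.rootScale]

/-- By `N * (2 * n + b) ^ (1 / p) = ‖(x, x, b * N)‖` with `x = N * n ^ (1 / p)`, an error `e` in `x`
costs at most `3 * e`, and rounding the norm costs at most `1` more. The resulting `3 * e + 1` is
within the next bound `4 * (e + 1) - 1`. -/
theorem rootScale_approx (hp : 1 ≤ p) (w N : ℕ) :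
    |(FineGrained.rootScale p w N : ℝ) - N * (w : ℝ) ^ (1 / p)| ≤ 4 ^ w.bits.length - 1 := by
  have hp0 : p ≠ 0 := by linarith
  induction w using Nat.binaryRec' with
  | zero => simp [FineGrained.rootScale, hp0]
  | bit b n hb ih =>
    have hbits := Nat.bits_append_bit n b hb
    rw [FineGrained.rootScale, hbits, List.foldr_cons, List.length_cons]
    rw [FineGrained.rootScale] at ih
    generalize n.bits.foldr (fun b h => FineGrained.normFloor p
      [h, h, if b = true then N else 0]) 0 = h at ih
    set x : ℝ := N * (n : ℝ) ^ (1 / p) with hx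
    set e : ℝ := 4 ^ n.bits.length - 1 with he
    have he0 : 0 ≤ e := (abs_nonneg _).trans ih
    set c : ℕ := if b = true then N else 0 with hc
    have h1 : listNorm p [x, x, (c : ℝ)] = N * ((Nat.bit b n : ℕ) : ℝ) ^ (1 / p) := by
      have hxp : |x| ^ p = N ^ p * n := by
        rw [abs_of_nonneg (by positivity), hx, Real.mul_rpow (by positivity) (by positivity),
          ← Real.rpow_mul (by positivity), one_div_mul_cancel hp0, Real.rpow_one]
      have hcp : |(c : ℝ)| ^ p = N ^ p * (b.toNat : ℕ) := by
        rw [hc]; cases b <;> simp [hp0]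
      rw [listNorm]
      simp only [List.map_cons, List.map_nil, List.sum_cons, List.sum_nil, hxp, hcp]
      have h2 : (N : ℝ) ^ p * n + (N ^ p * n + (N ^ p * (b.toNat : ℕ) + 0)) =
          N ^ p * ((Nat.bit b n : ℕ) : ℝ) := by
        rw [Nat.bit_val]; push_cast; ring
      rw [h2, Real.mul_rpow (by positivity) (by positivity), ← Real.rpow_mul (by positivity),
        mul_one_div_cancel hp0, Real.rpow_one]
    have h3 : ((([h, h, c] : List ℕ).map fun n : ℕ => (n : ℝ))) = [(h : ℝ), (h : ℝ), (c : ℝ)] :=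
      rfl
    have h4 := normFloor_le (p := p) [h, h, c]
    have h5 := le_normFloor_add_one (p := p) [h, h, c]
    rw [h3] at h4 h5
    have h6 : listNorm p [(h : ℝ), (h : ℝ), (c : ℝ)] ≤ listNorm p [x, x, (c : ℝ)] + 3 * e :=
      listNorm_le_add_mul hp (by simp [ih, he0])
    have h7 : listNorm p [x, x, (c : ℝ)] ≤ listNorm p [(h : ℝ), (h : ℝ), (c : ℝ)] + 3 * e :=
      listNorm_le_add_mul hp (by rw [abs_sub_comm] at ih; simp [ih, he0])
    rw [← h1, abs_le, pow_succ]
    constructor <;> linarith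

end Oracle

/-! ## The reduction from weighted Max-`k`-SAT to the closest vector problem -/

/-- A lower bound for the difference of two roots. -/
theorem div_le_rpow_sub_rpow {p u v : ℝ} (hp : 1 ≤ p) (hv : 0 ≤ v) (hvu : v ≤ u) :
    (u - v) / (p * (1 + u)) ≤ u ^ (1 / p) - v ^ (1 / p) := by
  have hp0 : 0 < p := by linarith
  have hu : 0 ≤ u := hv.trans hvu
  rcases hu.eq_or_lt with rfl | hu0
  · have : v = 0 := le_antisymm hvu hv
    simp [this]
  obtain ⟨s, hs⟩ : ∃ s, s = u ^ (1 / p) := ⟨_, rfl⟩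
  obtain ⟨t, ht⟩ : ∃ t, t = v ^ (1 / p) := ⟨_, rfl⟩
  have hs0 : 0 < s := hs ▸ Real.rpow_pos_of_pos hu0 _
  have ht0 : 0 ≤ t := ht ▸ Real.rpow_nonneg hv _
  have hsp : s ^ p = u := by rw [hs, ← Real.rpow_mul hu, one_div_mul_cancel hp0.ne', Real.rpow_one]
  have htp : t ^ p = v := by rw [ht, ← Real.rpow_mul hv, one_div_mul_cancel hp0.ne', Real.rpow_one]
  have hst : t ≤ s := by rw [hs, ht]; gcongr
  rw [← hs, ← ht, div_le_iff₀ (by positivity)]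
  -- Bernoulli's inequality for `(t / s) ^ p` gives `u - v ≤ p * (u / s) * (s - t)`.
  have h1 := one_add_mul_self_le_rpow_one_add (s := (t - s) / s)
    (by rw [le_div_iff₀ hs0]; linarith) hp
  have h2 : 1 + (t - s) / s = t / s := by field_simp; ring
  rw [h2, Real.div_rpow ht0 hs0.le, le_div_iff₀ (by positivity), hsp, htp] at h1
  -- Here `u / s = s ^ (p - 1)`, which is at most `1` for `s ≤ 1`; for `1 ≤ s` the quotient is at
  -- most `u`.
  have h3 : u / s ≤ 1 + u := by
    rcases le_total 1 s with h | h
    · exact (div_le_self hu h).trans (by linarith)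
    · rw [← hsp, ← Real.rpow_sub_one hs0.ne']
      have := Real.rpow_le_one hs0.le h (by linarith : 0 ≤ p - 1)
      have : 0 ≤ s ^ p := by positivity
      linarith
  have h4 : u - v ≤ p * (u / s) * (s - t) := by
    have : (1 + p * ((t - s) / s)) * u = u - p * (u / s) * (s - t) := by field_simp; ring
    linarith
  refine h4.trans ?_
  have h5 : 0 ≤ s - t := by linarith
  calc p * (u / s) * (s - t) ≤ p * (1 + u) * (s - t) := by gcongr
    _ = _ := by ring

/-- A literal: the sign and the index of the variable. -/
abbrev Lit : Type := Bool × Unary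

/-- The sign of a literal. -/
def litSign (b : Bool) : ℤ := if b = true then 1 else -1

/-- The signs of the literals of a clause, and whether they belong to the variable `j`. -/
def pattern (C : List Lit) (j : ℕ) : List (Bool × Bool) :=
  C.map fun l => (l.1, decide (l.2.val = j))

/-! ### The gadget of a clause in terms of the variables. -/

section Gadget
variable {k : ℕ}

/-- The coefficient of a variable in a row of the gadget of a clause. -/
def gadgetCoef (g : (Fin k → ℤ) × ℤ) (P : List (Bool × Bool)) : ℤ :=
  ∑ i : Fin k, if (P.getD i (false, false)).2 = true then
    2 * (g.1 i * litSign (P.getD i (false, false)).1) else 0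

/-- The target in a row of the gadget of a clause. -/
def gadgetConst (g : (Fin k → ℤ) × ℤ) (P : List (Bool × Bool)) : ℤ :=
  ∑ i : Fin k, g.1 i * litSign (P.getD i (false, false)).1 - g.2

theorem getD_take (P : List (Bool × Bool)) (i : Fin k) (a : Bool × Bool) :
    (P.take k).getD i a = P.getD i a := by
  simp [List.getD_eq_getElem?_getD, i.2]

theorem gadgetCoef_take (g : (Fin k → ℤ) × ℤ) (P : List (Bool × Bool)) :
    gadgetCoef g (P.take k) = gadgetCoef g P := by simp only [gadgetCoef, getD_take]

theorem gadgetConst_take (g : (Fin k → ℤ) × ℤ) (P : List (Bool × Bool)) :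
    gadgetConst g (P.take k) = gadgetConst g P := by simp only [gadgetConst, getD_take]

/-- Whether the assignment `y` satisfies a clause. -/
def satisfies (y : ℕ → Bool) (C : List Lit) : Prop := ∃ l ∈ C, y l.2.val = l.1

/-- With `y ∈ {0, 1}` a literal of sign `b` has the value `litSign b * (2 * y - 1) ∈ {1, -1}`. The
factor `2` goes to the lattice coefficient and the `-1` to the target. In `gadgetConst` only the
signs in the pattern matter, so the index `n` there is a dummy. -/
theorem gadget_value (g : (Fin k → ℤ) × ℤ) (C : List Lit) (hC : C.length = k) (n : ℕ)
    (y : ℕ → Bool) (hy : ∀ v, n ≤ v → y v = false) :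
    ∑ j : Fin n, gadgetCoef g (pattern C j) * (if y j = true then 1 else 0) -
      gadgetConst g (pattern C n) =
    ∑ i : Fin k, g.1 i * ((if y (C.get (i.cast hC.symm)).2.val = (C.get (i.cast hC.symm)).1
      then 1 else -1 : ℤˣ) : ℤ) + g.2 := by
  subst hC
  have hget : ∀ (i : Fin C.length) (j : ℕ), (pattern C j).getD i (false, false) =
      ((C.get i).1, decide ((C.get i).2.val = j)) := by
    intro i j
    simp [pattern, List.getD_eq_getElem?_getD]
  simp only [gadgetCoef, gadgetConst, hget, Finset.sum_mul]
  rw [Finset.sum_comm]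
  have h1 : ∀ i : Fin C.length, ∑ j : Fin n, (if decide ((C.get i).2.val = (j : ℕ)) = true then
      2 * (g.1 i * litSign (C.get i).1) else 0) * (if y j = true then 1 else 0) =
      2 * (g.1 i * litSign (C.get i).1) * (if y (C.get i).2.val = true then 1 else 0) := by
    intro i
    by_cases h : (C.get i).2.val < n
    · rw [Finset.sum_eq_single ⟨_, h⟩]
      · simp
      · intro j _ hj
        rw [if_neg, zero_mul]
        intro h2
        exact hj (Fin.ext (of_decide_eq_true h2).symm)
      · simp
    -- A variable from `n` on has no column; it is false, so its literal contributes through the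
    -- target alone.
    · rw [hy _ (by omega)]
      simp only [Bool.false_eq_true, if_false, mul_zero]
      refine Finset.sum_eq_zero fun j _ => ?_
      have := j.2
      rw [if_neg, zero_mul]
      intro h2
      have := of_decide_eq_true h2
      omega
  simp only [h1]
  rw [sub_sub_eq_add_sub, add_sub_right_comm, ← Finset.sum_sub_distrib]
  congr 1
  refine Finset.sum_congr rfl fun i _ => ?_
  simp only [Fin.cast_refl, id]
  cases y (C.get i).2.val <;> cases (C.get i).1 <;> simp [litSign] <;> ring

theorem gadget_sum {p A D : ℝ} {G : List ((Fin k → ℤ) × ℤ)}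
    (hG : ∀ x : Fin k → ℤˣ, (G.map fun g => |((∑ i, g.1 i * (x i : ℤ) + g.2 : ℤ) : ℝ)| ^ p).sum =
        if ∀ i, x i = -1 then A + D else A) (C : List Lit) (hC : C.length = k) (n : ℕ)
    (y : ℕ → Bool) (hy : ∀ v, n ≤ v → y v = false) [Decidable (satisfies y C)] :
    (G.map fun g => |((∑ j : Fin n, gadgetCoef g (pattern C j) * (if y j = true then 1 else 0) -
      gadgetConst g (pattern C n) : ℤ) : ℝ)| ^ p).sum = if satisfies y C then A else A + D := by
  simp only [gadget_value _ C hC n y hy]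
  rw [hG, ← ite_not]
  refine if_congr ?_ rfl rfl
  rw [not_iff_comm, satisfies]
  push Not
  constructor
  · intro h i
    rw [if_neg (h _ (List.get_mem _ _))]
  · intro h l hl hl2
    obtain ⟨i, rfl⟩ := List.get_of_mem hl
    have := h (i.cast hC)
    simp only [Fin.cast_cast, Fin.cast_refl, id] at this
    rw [if_pos hl2] at this
    exact absurd this (by decide)

end Gadget

/-- An approximation of `m * M * w ^ (1 / p)`. -/
noncomputable def scaled (p : ℝ) (M w : ℕ) (m : ℤ) : ℤ :=
  signed (decide (m < 0)) (rootScale p w (m.natAbs * M))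

theorem scaled_approx {p : ℝ} (hp : 1 ≤ p) (M w : ℕ) (m : ℤ) :
    |(scaled p M w m : ℝ) - M * (w : ℝ) ^ (1 / p) * m| ≤ 4 ^ w.bits.length - 1 := by
  have h := rootScale_approx hp w (m.natAbs * M)
  push_cast at h
  by_cases hm : m < 0
  · rw [scaled, signed, decide_eq_true hm, if_pos rfl]
    have h2 : ((m.natAbs : ℕ) : ℝ) = -m := by
      rw [← Int.cast_natCast, show (m.natAbs : ℤ) = -m by omega, Int.cast_neg]
    rw [← abs_neg]
    convert h using 2
    rw [h2]; push_cast; ring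
  · rw [scaled, signed, decide_eq_false hm]
    have h2 : ((m.natAbs : ℕ) : ℝ) = m := by
      rw [← Int.cast_natCast, show (m.natAbs : ℤ) = m by omega]
    convert h using 2
    rw [h2]; push_cast; simp; ring

/-! ### Coordinates of the lattice instance and their rounding errors. -/

section Rows
variable {k : ℕ}

/-- The coordinates: one for each variable, and those of the gadgets of the weighted clauses. -/
abbrev Row (k : ℕ) : Type := Unary ⊕ ((ℕ × List Lit) × ((Fin k → ℤ) × ℤ))

/-- The list of the coordinates. -/
def rows (n : ℕ) (G : List ((Fin k → ℤ) × ℤ)) (items : List (ℕ × List Lit)) : List (Row k) :=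
  ((List.range n).map fun i => Sum.inl (Unary.mk i)) ++
    items.flatMap fun it => G.map fun g => Sum.inr (it, g)

/-- A coordinate of the `j`-th lattice vector. -/
noncomputable def latticeEntry (p : ℝ) (a M j : ℕ) : Row k → ℤ
  | Sum.inl i => if i.val = j then 2 * (a : ℤ) else 0
  | Sum.inr (it, g) => scaled p M it.1 (gadgetCoef g (pattern it.2 j))

/-- A coordinate of the target. -/
noncomputable def targetEntry (p : ℝ) (a M n : ℕ) : Row k → ℤ
  | Sum.inl _ => a
  | Sum.inr (it, g) => scaled p M it.1 (gadgetConst g (pattern it.2 n))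

/-- A coordinate of the difference of a lattice vector and the target. -/
noncomputable def rowValue (p : ℝ) (a M : ℕ) {n : ℕ} (z : Fin n → ℤ) (r : Row k) : ℤ :=
  ∑ j : Fin n, latticeEntry p a M j r * z j - targetEntry p a M n r

theorem rowValue_inl (p : ℝ) (a M : ℕ) {n : ℕ} (z : Fin n → ℤ) (i : Fin n) :
    rowValue p a M z (Sum.inl (Unary.mk i) : Row k) = a * (2 * z i - 1) := by
  rw [rowValue, Finset.sum_eq_single i]
  · simp [latticeEntry, targetEntry]; ring
  · intro j _ hj
    have : (i : ℕ) ≠ j := fun h => hj (Fin.ext h.symm)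
    simp [latticeEntry, this]
  · simp

open Classical in
/-- The weighted number of the values of the gadgets. -/
noncomputable def gadgetWeight (A D : ℝ) (y : ℕ → Bool) (items : List (ℕ × List Lit)) : ℝ :=
  (items.map fun it => (it.1 : ℝ) * if satisfies y it.2 then A else A + D).sum

theorem sum_map_flatMap {α β : Type} (l : List α) (f : α → List β) (h : β → ℝ) :
    ((l.flatMap f).map h).sum = (l.map fun a => ((f a).map h).sum).sum := by
  induction l with
  | nil => rfl
  | cons a l ih => simp [ih]

theorem sum_map_range {n : ℕ} (h : ℕ → ℝ) : ((List.range n).map h).sum = ∑ i : Fin n, h i := by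
  rw [Fin.sum_univ_eq_sum_range]
  rfl

/-- With exact roots, the gadget rows of a clause of weight `w` contribute `M ^ p * w` times `A` or
`A + D`. Rounding moves a coordinate by at most `4 ^ ℓ` for each of the `n` columns and once more
for the target. -/
theorem listNorm_rows {p : ℝ} (hp : 1 ≤ p) {A D : ℝ} {G : List ((Fin k → ℤ) × ℤ)}
    (hG : ∀ x : Fin k → ℤˣ, (G.map fun g => |((∑ i, g.1 i * (x i : ℤ) + g.2 : ℤ) : ℝ)| ^ p).sum =
        if ∀ i, x i = -1 then A + D else A) {items : List (ℕ × List Lit)} {ℓ : ℕ}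
    (hlen : ∀ it ∈ items, it.2.length = k) (hℓ : ∀ it ∈ items, it.1.bits.length ≤ ℓ) (n a M : ℕ)
    (y : ℕ → Bool) (hy : ∀ v, n ≤ v → y v = false) :
    |listNorm p ((rows n G items).map fun r =>
        ((rowValue p a M (fun j : Fin n => if y j = true then 1 else 0) r : ℤ) : ℝ)) -
      (n * (a : ℝ) ^ p + M ^ p * gadgetWeight A D y items) ^ (1 / p)| ≤
      (n + items.length * G.length : ℕ) * ((n + 1) * 4 ^ ℓ) := by
  classical
  have hp0 : p ≠ 0 := by linarith
  set z : Fin n → ℤ := fun j => if y j = true then 1 else 0 with hz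
  have hlenRows : (rows n G items).length = n + items.length * G.length := by
    simp [rows, List.length_flatMap]
  let exact : Row k → ℝ := fun r => match r with
    | Sum.inl i => ((rowValue p a M z (Sum.inl i : Row k) : ℤ) : ℝ)
    | Sum.inr (it, g) => M * (it.1 : ℝ) ^ (1 / p) *
        ((∑ j : Fin n, gadgetCoef g (pattern it.2 j) * z j - gadgetConst g (pattern it.2 n) : ℤ) : ℝ)
  have h1 : listNorm p ((rows n G items).map exact) =
      (n * (a : ℝ) ^ p + M ^ p * gadgetWeight A D y items) ^ (1 / p) := by
    rw [listNorm, List.map_map, rows, List.map_append, List.sum_append, sum_map_flatMap]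
    congr 2
    · rw [List.map_map, sum_map_range]
      refine (Finset.sum_congr rfl fun i _ => ?_).trans
        (by simp : ∑ _i : Fin n, (a : ℝ) ^ p = _)
      simp only [Function.comp, exact, rowValue_inl, hz]
      cases y i <;> simp
    · rw [gadgetWeight, ← List.sum_map_mul_left]
      congr 1
      refine List.map_congr_left fun it hit => ?_
      rw [← gadget_sum hG it.2 (hlen it hit) n y hy, List.map_map, ← List.sum_map_mul_left,
        ← List.sum_map_mul_left]
      congr 1
      refine List.map_congr_left fun g _ => ?_
      simp only [Function.comp, exact]
      rw [abs_mul, abs_mul, Nat.abs_cast, abs_of_nonneg (by positivity : 0 ≤ (it.1 : ℝ) ^ (1 / p)),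
        Real.mul_rpow (by positivity) (by positivity), Real.mul_rpow (by positivity)
        (by positivity), ← Real.rpow_mul (by positivity), one_div_mul_cancel hp0, Real.rpow_one,
        mul_assoc]
  have hrow : ∀ r ∈ rows n G items,
      |((rowValue p a M z r : ℤ) : ℝ) - exact r| ≤ (n + 1) * 4 ^ ℓ := by
    intro r hr
    rcases r with i | ⟨it, g⟩
    · simp only [exact, sub_self, abs_zero]; positivity
    · have hit : it ∈ items := by
        simp only [rows, List.mem_append, List.mem_map, List.mem_flatMap] at hr
        rcases hr with ⟨_, _, h⟩ | ⟨it', h1, g', h2, h3⟩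
        · cases h
        · cases h3; exact h1
      have happ : ∀ m : ℤ, |(scaled p M it.1 m : ℝ) - M * (it.1 : ℝ) ^ (1 / p) * m| ≤ 4 ^ ℓ := by
        intro m
        refine (scaled_approx hp M it.1 m).trans ?_
        have : (4 : ℝ) ^ it.1.bits.length ≤ 4 ^ ℓ := by
          gcongr
          · norm_num
          · exact hℓ it hit
        linarith
      have hzle : ∀ j, |(z j : ℝ)| ≤ 1 := by
        intro j; simp only [hz]; cases y j <;> simp
      have heq : ((rowValue p a M z (Sum.inr (it, g) : Row k) : ℤ) : ℝ) - exact (Sum.inr (it, g)) =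
          ∑ j : Fin n, ((scaled p M it.1 (gadgetCoef g (pattern it.2 j)) : ℝ) -
            M * (it.1 : ℝ) ^ (1 / p) * (gadgetCoef g (pattern it.2 j) : ℤ)) * z j +
          -((scaled p M it.1 (gadgetConst g (pattern it.2 n)) : ℝ) -
            M * (it.1 : ℝ) ^ (1 / p) * (gadgetConst g (pattern it.2 n) : ℤ)) := by
        simp only [rowValue, latticeEntry, targetEntry, exact]
        push_cast
        simp only [sub_mul, Finset.sum_sub_distrib, mul_sub, Finset.mul_sum]
        simp only [mul_assoc]
        ring
      rw [heq]
      refine (abs_add_le _ _).trans ?_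
      rw [abs_neg, add_mul, one_mul]
      refine add_le_add ((Finset.abs_sum_le_sum_abs _ _).trans ?_) (happ _)
      refine (Finset.sum_le_card_nsmul Finset.univ _ (4 ^ ℓ : ℝ) fun j _ => ?_).trans (by simp)
      rw [abs_mul]
      exact (mul_le_mul (happ _) (hzle j) (abs_nonneg _) (by positivity)).trans (by simp)
  rw [abs_le, ← h1]
  have hF : ∀ l : List (Row k), (∀ r ∈ l, |((rowValue p a M z r : ℤ) : ℝ) - exact r| ≤
      (n + 1) * 4 ^ ℓ) → List.Forall₂ (fun x y => |x - y| ≤ ((n + 1) * 4 ^ ℓ : ℝ))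
        (l.map fun r => ((rowValue p a M z r : ℤ) : ℝ)) (l.map exact) := by
    intro l hl
    rw [List.forall₂_map_left_iff, List.forall₂_map_right_iff, List.forall₂_same]
    exact hl
  have h2 := listNorm_le_add_mul hp (hF _ hrow)
  have h3 := listNorm_le_add_mul hp ((hF _ hrow).flip.imp fun x y h => by
    rw [abs_sub_comm]; exact h)
  rw [List.length_map, hlenRows] at h2 h3
  constructor <;> linarith

end Rows

/-! ### Correctness of the reduction -/

theorem exists_le_two_pow (x : ℝ) : ∃ K : ℕ, x ≤ 2 ^ K := by
  obtain ⟨K, hK⟩ := pow_unbounded_of_one_lt x (by norm_num : (1 : ℝ) < 2)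
  exact ⟨K, hK.le⟩

/-- `X` will be the gadget weight of the reference vector, and `2 ^ (c₁ * L)` the ratio of `a` to
`M`. The first inequality makes non-binary coefficients too expensive; the second says that `M = 2 ^
(c₂ * L)` times the gap of the roots exceeds twice the rounding error, with room for the integer
distance bound. -/
theorem exists_parameters {p A D : ℝ} (hp : 1 ≤ p) (hA : 0 ≤ A) (hD : 0 < D) (ρ : ℕ) :
    ∃ c₁ c₂ : ℕ, ∀ n m L : ℕ, n < L → m ≤ L → ∀ X : ℝ, D ≤ X → X ≤ (A + D) * 2 ^ L →
      X + D ≤ ((2 : ℝ) ^ (c₁ * L)) ^ p ∧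
      2 * ((n + m * ρ : ℕ) * ((n + 1) * 4 ^ L)) + 2 ≤
        (2 : ℝ) ^ (c₂ * L) * (D / (p * (1 + (n * ((2 : ℝ) ^ (c₁ * L)) ^ p + X + D)))) := by
  obtain ⟨K₁, hK₁⟩ := exists_le_two_pow (A + 2 * D)
  obtain ⟨P, hP⟩ := exists_nat_ge p
  obtain ⟨K, hK⟩ := exists_le_two_pow ((4 + 2 * ρ) * p * (2 + A + 2 * D) / D)
  -- The `5` pays for the factors `2 ^ L * 2 ^ L * 4 ^ L` of the error and one more `2 ^ L` in the
  -- denominator; `(K₁ + 1) * P` pays for the `p`-th power of `2 ^ (c₁ * L)`.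
  refine ⟨K₁ + 1, K + 5 + (K₁ + 1) * P, fun n m L hn hm X hX hX' => ?_⟩
  set c₁ := K₁ + 1 with hc₁
  have hL : 1 ≤ L := by omega
  have hL2 : (1 : ℝ) ≤ 2 ^ L := one_le_pow₀ (by norm_num)
  have hLlt : (L : ℝ) ≤ 2 ^ L := by exact_mod_cast Nat.lt_two_pow_self.le
  have ha1 : (1 : ℝ) ≤ 2 ^ (c₁ * L) := one_le_pow₀ (by norm_num)
  have ha : (2 : ℝ) ^ (c₁ * L) ≤ ((2 : ℝ) ^ (c₁ * L)) ^ p := by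
    simpa using Real.rpow_le_rpow_of_exponent_le ha1 hp
  have hb : ((2 : ℝ) ^ (c₁ * L)) ^ p ≤ 2 ^ (c₁ * P * L) := by
    refine (Real.rpow_le_rpow_of_exponent_le ha1 hP).trans (le_of_eq ?_)
    rw [Real.rpow_natCast, ← pow_mul]
    congr 1; ring
  constructor
  · refine le_trans ?_ ha
    have h1 : (2 : ℝ) ^ K₁ * 2 ^ L ≤ 2 ^ (c₁ * L) := by
      rw [← pow_add]
      refine pow_le_pow_right₀ (by norm_num) ?_
      rw [hc₁, add_mul, one_mul]
      exact Nat.add_le_add_right (Nat.le_mul_of_pos_right _ hL) _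
    refine le_trans ?_ h1
    calc X + D ≤ (A + D) * 2 ^ L + D * 2 ^ L := by nlinarith
      _ = (A + 2 * D) * 2 ^ L := by ring
      _ ≤ _ := by gcongr
  · set b : ℝ := ((2 : ℝ) ^ (c₁ * L)) ^ p with hbdef
    have hb0 : 0 < b := by linarith
    set Y : ℝ := 2 ^ (c₁ * P * L) with hY
    have hY1 : 1 ≤ Y := one_le_pow₀ (by norm_num)
    have hLY : (1 : ℝ) ≤ 2 ^ L * Y := by nlinarith
    have hn' : (n : ℝ) ≤ 2 ^ L := le_trans (by exact_mod_cast hn.le) hLlt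
    have h1 : 1 + (n * b + X + D) ≤ (2 + A + 2 * D) * (2 ^ L * Y) := by
      have e1 : n * b ≤ 2 ^ L * Y := by gcongr
      have e2 : (A + D) * 2 ^ L ≤ (A + D) * (2 ^ L * Y) := by
        gcongr
        nlinarith
      have e3 : D ≤ D * (2 ^ L * Y) := le_mul_of_one_le_right hD.le hLY
      nlinarith
    have h2 : (2 * ((n + m * ρ : ℕ) * ((n + 1) * 4 ^ L)) + 2 : ℝ) ≤
        (4 + 2 * ρ) * (2 ^ L * 2 ^ L * 4 ^ L) := by
      have e1 : ((n + m * ρ : ℕ) : ℝ) ≤ (1 + ρ) * 2 ^ L := by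
        have : (m : ℝ) ≤ 2 ^ L := le_trans (by exact_mod_cast hm) hLlt
        push_cast
        nlinarith [mul_le_mul_of_nonneg_right this (Nat.cast_nonneg (α := ℝ) ρ)]
      have e2 : ((n : ℝ) + 1) ≤ 2 ^ L := le_trans (by exact_mod_cast hn) hLlt
      have e3 : ((n + m * ρ : ℕ) * ((n + 1) * 4 ^ L) : ℝ) ≤ ((1 + ρ) * 2 ^ L) * (2 ^ L * 4 ^ L) := by
        gcongr
      have e4 : (1 : ℝ) ≤ 2 ^ L * 2 ^ L * 4 ^ L := by
        have : (1 : ℝ) ≤ 4 ^ L := one_le_pow₀ (by norm_num)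
        nlinarith [mul_le_mul hL2 hL2 zero_le_one (by positivity)]
      nlinarith
    have hnb : 0 ≤ n * b := by positivity
    have hpos : 0 < p * (1 + (n * b + X + D)) := by
      have : 0 < p := by linarith
      have : 0 < 1 + (n * b + X + D) := by linarith
      positivity
    refine h2.trans ?_
    rw [mul_div_assoc', le_div_iff₀ hpos]
    have h3 : (2 : ℝ) ^ K * (2 ^ L * 2 ^ L * 4 ^ L * (2 ^ L * Y)) ≤
        2 ^ ((K + 5 + c₁ * P) * L) := by
      have e1 : (2 : ℝ) ^ ((K + 5 + c₁ * P) * L) =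
          2 ^ (K * L) * (2 ^ L * 2 ^ L * 4 ^ L * (2 ^ L * Y)) := by
        rw [hY, show (4 : ℝ) = 2 ^ 2 by norm_num, ← pow_mul]
        simp only [← pow_add]
        congr 1; ring
      rw [e1]
      gcongr
      · norm_num
      · exact Nat.le_mul_of_pos_right _ hL
    rw [div_le_iff₀ hD] at hK
    have hp0 : 0 ≤ p := by linarith
    calc (4 + 2 * ρ) * (2 ^ L * 2 ^ L * 4 ^ L) * (p * (1 + (n * b + X + D)))
        ≤ (4 + 2 * ρ) * (2 ^ L * 2 ^ L * 4 ^ L) * (p * ((2 + A + 2 * D) * (2 ^ L * Y))) := by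
          gcongr
      _ = (4 + 2 * ρ) * p * (2 + A + 2 * D) * (2 ^ L * 2 ^ L * 4 ^ L * (2 ^ L * Y)) := by ring
      _ ≤ 2 ^ K * D * (2 ^ L * 2 ^ L * 4 ^ L * (2 ^ L * Y)) := by gcongr
      _ = 2 ^ K * (2 ^ L * 2 ^ L * 4 ^ L * (2 ^ L * Y)) * D := by ring
      _ ≤ 2 ^ ((K + 5 + c₁ * P) * L) * D := by gcongr

/-! ### Weighted clauses for the lattice and for the reference vector. -/

section Items

/-- A clause whose literals do not depend on the variables below `n`. -/
def constClause (k n : ℕ) (b : Bool) : List Lit := List.replicate k (!b, Unary.mk n)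

/-- The variable `n` lies just outside the formula and is false under every assignment considered,
so these clauses have a fixed truth value while using the same gadget. -/
theorem satisfies_constClause {k n : ℕ} (hk : 1 ≤ k) {y : ℕ → Bool} (hy : y n = false) (b : Bool) :
    satisfies y (constClause k n b) ↔ b = true := by
  simp [satisfies, constClause, hy]
  cases b <;> simp; omega

/-- The weighted clauses of the lattice. -/
def latticeItems (k n : ℕ) (cl : List (ℕ × List Lit)) (W : ℕ) : List (ℕ × List Lit) :=
  cl.map (fun c => (2 * c.1, c.2)) ++ [(2 * W, constClause k n false), (1, constClause k n true)]

/-- The weighted clauses that determine the distance bound. -/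
def boundItems (k n : ℕ) (cl : List (ℕ × List Lit)) (W : ℕ) : List (ℕ × List Lit) :=
  cl.map (fun c => (2 * c.1, constClause k n false)) ++
    [(2 * W, constClause k n true), (1, constClause k n false)]

/-- A bound for the number of variables, the number of items, and their weights. -/
def itemsBound (n : ℕ) (items : List (ℕ × List Lit)) : ℕ :=
  (items.flatMap fun it => true :: it.1.bits).length + n

/-- Both lists carry the same weights in the same order, so a common `L`, and thus common scales,
serve for both. -/
theorem itemsBound_eq (k n : ℕ) (cl : List (ℕ × List Lit)) (W : ℕ) :
    itemsBound n (boundItems k n cl W) = itemsBound n (latticeItems k n cl W) := by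
  simp [itemsBound, boundItems, latticeItems, List.length_flatMap, Function.comp_def]

theorem length_le_itemsBound (n : ℕ) (items : List (ℕ × List Lit)) :
    items.length + n ≤ itemsBound n items := by
  unfold itemsBound
  induction items with
  | nil => simp
  | cons it l ih => simp at ih ⊢; omega

theorem bits_le_itemsBound (n : ℕ) (items : List (ℕ × List Lit)) :
    ∀ it ∈ items, it.1.bits.length ≤ itemsBound n items := by
  unfold itemsBound
  induction items with
  | nil => simp
  | cons it l ih =>
    intro it' h
    rcases List.mem_cons.1 h with rfl | h
    · simp; omega
    · have := ih it' h
      simp at this ⊢; omega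

theorem sum_lt_itemsBound (n : ℕ) (items : List (ℕ × List Lit)) :
    (items.map Prod.fst).sum < 2 ^ itemsBound n items := by
  refine (sum_lt_two_pow _).trans_le (Nat.pow_le_pow_right (by norm_num) ?_)
  unfold itemsBound
  induction items with
  | nil => simp
  | cons it l ih => simp at ih ⊢; omega

theorem gadgetWeight_le {A D : ℝ} (hD : 0 < D) (y : ℕ → Bool)
    (items : List (ℕ × List Lit)) :
    gadgetWeight A D y items ≤ (A + D) * ((items.map Prod.fst).sum : ℕ) := by
  classical
  unfold gadgetWeight
  induction items with
  | nil => simp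
  | cons it l ih =>
    simp only [List.map_cons, List.sum_cons]
    push_cast at ih ⊢
    rw [mul_add]
    refine add_le_add ?_ ih
    rw [mul_comm (A + D)]
    gcongr
    split_ifs <;> linarith

theorem gadgetWeight_nonneg {A D : ℝ} (hA : 0 ≤ A) (hD : 0 < D) (y : ℕ → Bool)
    (items : List (ℕ × List Lit)) : 0 ≤ gadgetWeight A D y items := by
  classical
  refine List.sum_nonneg fun x hx => ?_
  obtain ⟨it, -, rfl⟩ := List.mem_map.1 hx
  split_ifs <;> positivity

open Classical in
/-- The weight of the satisfied clauses. -/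
noncomputable def satWeight (y : ℕ → Bool) (cl : List (ℕ × List Lit)) : ℕ :=
  (cl.map fun c => if satisfies y c.2 then c.1 else 0).sum

/-- Equal total weights cancel all multiples of `A`. Doubling the weights and adding one clause of
weight `1` puts the reference value strictly between YES and NO: the difference is at most `-D` if
the satisfied weight reaches `W`, and at least `D` otherwise. -/
theorem gadgetWeight_sub {k n : ℕ} (hk : 1 ≤ k) (A D : ℝ) {y y' : ℕ → Bool} (hy : y n = false)
    (hy' : y' n = false) (cl : List (ℕ × List Lit)) (W : ℕ) :
    gadgetWeight A D y (latticeItems k n cl W) - gadgetWeight A D y' (boundItems k n cl W) =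
      D * (2 * ((W : ℝ) - satWeight y cl) - 1) := by
  classical
  unfold gadgetWeight latticeItems boundItems satWeight
  simp only [List.map_append, List.map_cons, List.map_nil, List.sum_append, List.sum_cons,
    List.sum_nil, satisfies_constClause hk hy, satisfies_constClause hk hy', List.map_map,
    Function.comp_def, Bool.false_eq_true, if_true, if_false]
  induction cl with
  | nil => simp; ring
  | cons c l ih =>
    simp only [List.map_cons, List.sum_cons]
    push_cast at ih ⊢
    split_ifs <;> linear_combination ih

theorem le_gadgetWeight_boundItems {k n : ℕ} (hk : 1 ≤ k) {A D : ℝ} (hA : 0 ≤ A) (hD : 0 < D)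
    {y : ℕ → Bool} (hy : y n = false) (cl : List (ℕ × List Lit)) (W : ℕ) :
    D ≤ gadgetWeight A D y (boundItems k n cl W) := by
  classical
  have h1 := gadgetWeight_nonneg hA hD y (cl.map fun c => (2 * c.1, constClause k n false))
  unfold gadgetWeight at h1 ⊢
  unfold boundItems
  simp only [List.map_append, List.map_cons, List.map_nil, List.sum_append, List.sum_cons,
    List.sum_nil, satisfies_constClause hk hy, Bool.false_eq_true, if_true, if_false]
  have : 0 ≤ ((2 * W : ℕ) : ℝ) * A := by positivity
  push_cast at this ⊢
  linarith

end Items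

/-! ### Separation of YES and NO instances. -/

section Correctness
variable {k : ℕ} {p A D : ℝ}

/-- An integer other than `0` and `1` has `|2 * z - 1| ≥ 3`, and `3 ^ p ≥ 3`, so its coordinate
exceeds the usual `a ^ p` by at least `2 * a ^ p`. All other variables still contribute at least `a
^ p`. -/
theorem le_listNorm_rows_of_not_binary (hp : 1 ≤ p) (G : List ((Fin k → ℤ) × ℤ))
    (items : List (ℕ × List Lit)) {n : ℕ} (a M : ℕ) (z : Fin n → ℤ)
    (hz : ∃ j, z j ≠ 0 ∧ z j ≠ 1) :
    ((n : ℝ) * (a : ℝ) ^ p + 2 * (a : ℝ) ^ p) ^ (1 / p) ≤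
      listNorm p ((rows n G items).map fun r => ((rowValue p a M z r : ℤ) : ℝ)) := by
  obtain ⟨j, hj0, hj1⟩ := hz
  unfold listNorm
  gcongr
  rw [rows, List.map_append, List.map_append, List.sum_append]
  refine le_add_of_le_of_nonneg ?_ (sum_abs_rpow_nonneg _)
  rw [List.map_map, List.map_map, sum_map_range]
  simp only [Function.comp_def, rowValue_inl]
  have h1 : ∀ i, (a : ℝ) ^ p + (if i = j then 2 * (a : ℝ) ^ p else 0) ≤
      |((a * (2 * z i - 1) : ℤ) : ℝ)| ^ p := by
    intro i
    push_cast
    rw [abs_mul, Nat.abs_cast, Real.mul_rpow (by positivity) (abs_nonneg _)]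
    have hap : 0 ≤ (a : ℝ) ^ p := by positivity
    split_ifs with hij
    · subst hij
      have h2 : (3 : ℝ) ≤ |2 * (z i : ℝ) - 1| := by
        have : (3 : ℤ) ≤ |2 * z i - 1| := by
          rw [le_abs]; omega
        exact_mod_cast this
      have h3 : (3 : ℝ) ≤ |2 * (z i : ℝ) - 1| ^ p :=
        h2.trans (by simpa using Real.rpow_le_rpow_of_exponent_le (by linarith) hp)
      nlinarith
    · have h2 : (1 : ℝ) ≤ |2 * (z i : ℝ) - 1| := by
        have : (1 : ℤ) ≤ |2 * z i - 1| := by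
          rw [le_abs]; omega
        exact_mod_cast this
      have h3 : (1 : ℝ) ≤ |2 * (z i : ℝ) - 1| ^ p := Real.one_le_rpow h2 (by linarith)
      nlinarith
  refine le_trans (le_of_eq ?_) (Finset.sum_le_sum fun i _ => h1 i)
  rw [Finset.sum_add_distrib]
  simp

/-- The distance bound. -/
noncomputable def distanceBound (p : ℝ) (a M n : ℕ) (G : List ((Fin k → ℤ) × ℤ))
    (items : List (ℕ × List Lit)) : ℕ :=
  normFloor p ((rows n G items).map fun r => (targetEntry p a M n r).natAbs)

/-- At `z = 0` the difference vector is minus the target. The zero vector is written with `if false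
= true` to match `listNorm_rows` for the constantly false assignment. -/
theorem distanceBound_spec (a M n : ℕ) (G : List ((Fin k → ℤ) × ℤ))
    (items : List (ℕ × List Lit)) :
    (distanceBound p a M n G items : ℝ) ≤ listNorm p ((rows n G items).map fun r =>
      ((rowValue p a M (fun _ : Fin n => if false = true then 1 else 0) r : ℤ) : ℝ)) ∧
    listNorm p ((rows n G items).map fun r =>
      ((rowValue p a M (fun _ : Fin n => if false = true then 1 else 0) r : ℤ) : ℝ)) ≤
        distanceBound p a M n G items + 1 := by
  have h : listNorm p (((rows n G items).map fun r => (targetEntry p a M n r).natAbs).map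
      fun m : ℕ => (m : ℝ)) = listNorm p ((rows n G items).map fun r =>
        ((rowValue p a M (fun _ : Fin n => if false = true then 1 else 0) r : ℤ) : ℝ)) := by
    unfold listNorm
    congr 2
    rw [List.map_map, List.map_map, List.map_map]
    refine List.map_congr_left fun r _ => ?_
    simp [rowValue, Nat.cast_natAbs]
  rw [← h]
  exact ⟨normFloor_le _, le_normFloor_add_one _⟩

/-- Up to the factor `M` and an error `E`, the reference norm is `u ^ (1 / p)`, while lattice
vectors give at most `(u - D) ^ (1 / p)` in the YES case and at least `(u + D) ^ (1 / p)` in the NO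
case. Both gaps are at least `g`, and `M * g ≥ 2 * E + 2` absorbs the two errors and the rounding of
the reference norm to `r`. -/
theorem reduction_spec (hp : 1 ≤ p) (hk : 1 ≤ k) (hA : 0 ≤ A) (hD : 0 < D)
    {G : List ((Fin k → ℤ) × ℤ)}
    (hG : ∀ x : Fin k → ℤˣ, (G.map fun g => |((∑ i, g.1 i * (x i : ℤ) + g.2 : ℤ) : ℝ)| ^ p).sum =
        if ∀ i, x i = -1 then A + D else A) :
    ∃ c₁ c₂ : ℕ, ∀ (n : ℕ) (cl : List (ℕ × List Lit)) (W L a M r : ℕ),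
      (∀ c ∈ cl, c.2.length = k) → L = itemsBound n (latticeItems k n cl W) →
      a = 2 ^ (c₁ * L) → M = 2 ^ (c₂ * L) →
      r = distanceBound p a M n G (boundItems k n cl W) →
      0 < r ∧ ∀ z : Fin n → ℤ,
        (∀ y : ℕ → Bool, (∀ v, n ≤ v → y v = false) → W ≤ satWeight y cl →
          (∀ j, z j = if y j = true then 1 else 0) →
          listNorm p ((rows n G (latticeItems k n cl W)).map
            fun r => ((rowValue p a M z r : ℤ) : ℝ)) ≤ r) ∧
        ((∀ y : ℕ → Bool, (∀ v, n ≤ v → y v = false) →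
          (∀ j, z j = if y j = true then 1 else 0) → satWeight y cl < W) →
          (r + 1 : ℝ) ≤ listNorm p ((rows n G (latticeItems k n cl W)).map
            fun r => ((rowValue p a M z r : ℤ) : ℝ))) := by
  have hp0 : 0 < p := by linarith
  obtain ⟨c₁, c₂, hc⟩ := exists_parameters hp hA hD G.length
  -- The scale `a` is `M * 2 ^ (c₁ * L)`, so that `M ^ p` factors out of the whole sum.
  refine ⟨c₁ + c₂, c₂, fun n cl W L a M r hcl hL ha hM hr => ?_⟩
  set I := latticeItems k n cl W with hI
  set T := boundItems k n cl W with hT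
  set y₀ : ℕ → Bool := fun _ => false with hy₀
  set X := gadgetWeight A D y₀ T with hX
  have hTL : itemsBound n T = L := by rw [hL]; exact itemsBound_eq k n cl W
  have hlenT : T.length = I.length := by simp [hI, hT, latticeItems, boundItems]
  have hI1 : 1 ≤ I.length := by simp [hI, latticeItems]
  have hnL : I.length + n ≤ L := hL ▸ length_le_itemsBound n I
  have hXD : D ≤ X := le_gadgetWeight_boundItems hk hA hD rfl cl W
  have hXle : X ≤ (A + D) * 2 ^ L := by
    refine (gadgetWeight_le hD y₀ T).trans ?_
    have := sum_lt_itemsBound n T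
    rw [hTL] at this
    gcongr
    exact_mod_cast this.le
  obtain ⟨h1, h2⟩ := hc n I.length L (by omega) (by omega) X hXD hXle
  set b : ℝ := ((2 : ℝ) ^ (c₁ * L)) ^ p with hb
  set E : ℝ := (n + I.length * G.length : ℕ) * ((n + 1) * 4 ^ L) with hE
  set u : ℝ := n * b + X with hu
  have hE0 : 0 ≤ E := by positivity
  have hb0 : 0 ≤ b := by positivity
  have hDu : D ≤ u := hXD.trans (le_add_of_nonneg_left (by positivity))
  have hMpos : 0 < (M : ℝ) := by rw [hM]; positivity
  have hap : (a : ℝ) ^ p = M ^ p * b := by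
    rw [ha, hM, hb, add_mul, pow_add]
    push_cast
    rw [Real.mul_rpow (by positivity) (by positivity), mul_comm]
  have hroot : ∀ x : ℝ, 0 ≤ x → ((M : ℝ) ^ p * x) ^ (1 / p) = M * x ^ (1 / p) := by
    intro x hx
    rw [Real.mul_rpow (by positivity) hx, ← Real.rpow_mul hMpos.le, mul_one_div_cancel hp0.ne',
      Real.rpow_one]
  set g : ℝ := D / (p * (1 + (u + D))) with hg
  have hMg : 2 * E + 2 ≤ M * g := by
    rw [hM]; push_cast
    exact h2
  have hup : g ≤ (u + D) ^ (1 / p) - u ^ (1 / p) := by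
    have := div_le_rpow_sub_rpow hp (by linarith : 0 ≤ u) (by linarith : u ≤ u + D)
    rwa [add_sub_cancel_left] at this
  have hdown : g ≤ u ^ (1 / p) - (u - D) ^ (1 / p) := by
    have := div_le_rpow_sub_rpow hp (by linarith : 0 ≤ u - D) (by linarith : u - D ≤ u)
    rw [sub_sub_cancel] at this
    refine le_trans ?_ this
    have h0 : 0 < p * (1 + u) := mul_pos hp0 (by linarith)
    rw [hg]
    gcongr
    linarith
  have hlenI : ∀ it ∈ I, it.2.length = k := by
    intro it hit
    simp only [hI, latticeItems, List.mem_append, List.mem_map, List.mem_cons, List.not_mem_nil,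
      or_false] at hit
    rcases hit with ⟨c, hc, rfl⟩ | rfl | rfl
    · exact hcl c hc
    · simp [constClause]
    · simp [constClause]
  have hlenT' : ∀ it ∈ T, it.2.length = k := by
    intro it hit
    simp only [hT, boundItems, List.mem_append, List.mem_map, List.mem_cons, List.not_mem_nil,
      or_false] at hit
    rcases hit with ⟨c, hc, rfl⟩ | rfl | rfl <;> simp [constClause]
  have hR := listNorm_rows hp hG hlenT' (ℓ := L) (hTL ▸ bits_le_itemsBound n T) n a M y₀
    fun _ _ => rfl
  rw [hlenT, ← hE, hap, ← hX, mul_left_comm, ← mul_add, ← hu, hroot u (by linarith), abs_le] at hR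
  obtain ⟨hr1, hr2⟩ := distanceBound_spec (p := p) a M n G T
  rw [← hr] at hr1 hr2
  set R := listNorm p ((rows n G T).map fun r =>
    ((rowValue p a M (fun _ : Fin n => if false = true then 1 else 0) r : ℤ) : ℝ)) with hRdef
  have hR1 : -E ≤ R - M * u ^ (1 / p) := hR.1
  have hR2 : R - M * u ^ (1 / p) ≤ E := hR.2
  have hMup := mul_le_mul_of_nonneg_left hup hMpos.le
  have hMdown := mul_le_mul_of_nonneg_left hdown hMpos.le
  rw [mul_sub] at hMup hMdown
  have hvalue : ∀ y : ℕ → Bool, (∀ v, n ≤ v → y v = false) →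
      |listNorm p ((rows n G I).map fun r =>
        ((rowValue p a M (fun j : Fin n => if y j = true then 1 else 0) r : ℤ) : ℝ)) -
        M * (u + D * (2 * ((W : ℝ) - satWeight y cl) - 1)) ^ (1 / p)| ≤ E := by
    intro y hy
    have h3 := listNorm_rows hp hG hlenI (ℓ := L) (hL ▸ bits_le_itemsBound n I) n a M y hy
    have h4 := gadgetWeight_sub hk A D (y' := y₀) (hy n le_rfl) rfl cl W
    have h5 := gadgetWeight_nonneg hA hD y I
    have h6 : n * b + gadgetWeight A D y I = u + D * (2 * ((W : ℝ) - satWeight y cl) - 1) := by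
      rw [← h4, hu]; ring
    rw [← hE, hap, mul_left_comm, ← mul_add, h6, hroot _ (by rw [← h6]; positivity)] at h3
    exact h3
  have hpos : 0 ≤ (u - D) ^ (1 / p) := Real.rpow_nonneg (by linarith) _
  have hMpos' := mul_nonneg hMpos.le hpos
  refine ⟨?_, fun z => ⟨fun y hy hW hz => ?_, fun hno => ?_⟩⟩
  · have : (0 : ℝ) < r := by linarith
    exact_mod_cast this
  · obtain rfl : z = fun j : Fin n => if y j = true then 1 else 0 := funext hz
    have h3 := (abs_le.1 (hvalue y hy)).2
    have h5 := gadgetWeight_nonneg hA hD y I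
    have h4 := gadgetWeight_sub hk A D (y' := y₀) (hy n le_rfl) rfl cl W
    have h6 : (u + D * (2 * ((W : ℝ) - satWeight y cl) - 1)) ^ (1 / p) ≤ (u - D) ^ (1 / p) := by
      have : (W : ℝ) ≤ satWeight y cl := by exact_mod_cast hW
      refine Real.rpow_le_rpow ?_ ?_ (by positivity)
      · rw [← h4, hu]
        have : 0 ≤ n * b := by positivity
        linarith
      · linarith [mul_nonneg hD.le (sub_nonneg.2 this)]
    have h7 := mul_le_mul_of_nonneg_left h6 hMpos.le
    linarith
  · have hlow : M * (u + D) ^ (1 / p) - E ≤ listNorm p ((rows n G I).map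
        fun r => ((rowValue p a M z r : ℤ) : ℝ)) := by
      by_cases hz : ∃ j, z j ≠ 0 ∧ z j ≠ 1
      -- A non-binary vector exceeds even the NO bound, because `X + D ≤ b`.
      · refine le_trans ?_ (le_listNorm_rows_of_not_binary hp G I a M z hz)
        rw [hap, show (n : ℝ) * (M ^ p * b) + 2 * (M ^ p * b) = M ^ p * (n * b + 2 * b) by ring,
          hroot _ (by positivity)]
        have h3 : (u + D) ^ (1 / p) ≤ (n * b + 2 * b) ^ (1 / p) :=
          Real.rpow_le_rpow (by linarith) (by linarith) (by positivity)
        have h7 := mul_le_mul_of_nonneg_left h3 hMpos.le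
        linarith
      · push Not at hz
        let y : ℕ → Bool := fun v => if h : v < n then decide (z ⟨v, h⟩ = 1) else false
        have hy : ∀ v, n ≤ v → y v = false := fun v hv => by simp [y, hv]
        have hzy : ∀ j, z j = if y j = true then 1 else 0 := by
          intro j
          by_cases h : z j = 0
          · simp [y, h]
          · simp [y, hz j h]
        have hW := hno y hy hzy
        have hz' : z = fun j : Fin n => if y j = true then 1 else 0 := funext hzy
        have h3 := (abs_le.1 (hvalue y hy)).1
        rw [← hz'] at h3
        have h6 : (u + D) ^ (1 / p) ≤ (u + D * (2 * ((W : ℝ) - satWeight y cl) - 1)) ^ (1 / p) := by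
          have : (satWeight y cl : ℝ) + 1 ≤ W := by exact_mod_cast hW
          refine Real.rpow_le_rpow (by linarith) ?_ (by positivity)
          linarith [mul_nonneg hD.le (sub_nonneg.2 this)]
        have h7 := mul_le_mul_of_nonneg_left h6 hMpos.le
        linarith
    linarith

end Correctness

/-! ### The reduction is computed in polynomial time -/

section Program
variable {α : Type} [Enc α] {k : ℕ} {p δ : ℝ}

theorem PolyTime.shiftMul (c : ℕ) {f : α → ℕ} {u : α → Unary} (hf : PolyTime f)
    (hu : PolyTime u) : PolyTime fun a => f a * 2 ^ (c * (u a).val) := by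
  induction c with
  | zero => simpa using hf
  | succ c ih => exact (ih.shift hu).of_eq fun a => by ring

theorem PolyTime.twoPow (c : ℕ) {u : α → Unary} (hu : PolyTime u) :
    PolyTime fun a => 2 ^ (c * (u a).val) :=
  ((PolyTime.const 1).shiftMul c hu).of_eq fun a => by ring

theorem PolyTime.double {f : α → ℕ} (hf : PolyTime f) : PolyTime fun a => 2 * f a :=
  ((PolyTime.const false).bit hf).of_eq fun a => by simp [Nat.bit_val]

theorem PolyTime.constClause {u : α → Unary} (hu : PolyTime u) (b : Bool) :
    PolyTime fun a => FineGrained.constClause k (u a).val b :=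
  (PolyTime.map (g := fun a _ => (!b, u a)) (.const (List.replicate k ()))
    ((PolyTime.const (!b)).pair (hu.comp .fst))).of_eq fun a => by
      simp [FineGrained.constClause]

theorem PolyTime.scaled (hp : 1 ≤ p) (h : (CVP p).SolvableInTimeTwoPow δ) (c : ℕ)
    {L : α → Unary} {w : α → ℕ} {m : α → ℤ} (hL : PolyTime L) (hw : PolyTime w)
    (hm : PolyTime m) : PolyTime fun a => FineGrained.scaled p (2 ^ (c * (L a).val)) (w a) (m a) :=
  hm.isNeg.signed (.rootScale hp h hw (hm.natAbs.shiftMul c hL))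

/-- A gadget entry depends only on the first `k` members of the pattern, so `PolyTime.table`
evaluates `F` for every row of the fixed gadget `G`; lattice and target entries are both covered by
the choice of `F`. -/
theorem PolyTime.gadgetRows (hp : 1 ≤ p) (h : (CVP p).SolvableInTimeTwoPow δ) (c : ℕ)
    (G : List ((Fin k → ℤ) × ℤ)) (F : (Fin k → ℤ) × ℤ → List (Bool × Bool) → ℤ)
    (hF : ∀ g P, F g (P.take k) = F g P) {L j : α → Unary} {items : α → List (ℕ × List Lit)}
    (hL : PolyTime L) (hj : PolyTime j) (hitems : PolyTime items) :
    PolyTime fun a => (items a).flatMap fun it => G.map fun g =>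
      FineGrained.scaled p (2 ^ (c * (L a).val)) it.1 (F g (pattern it.2 (j a).val)) := by
  have hC : PolyTime fun x : α × ℕ × List Lit => x.2.2 := PolyTime.snd.comp .snd
  have hj' : PolyTime fun x : (α × ℕ × List Lit) × Lit => j x.1.1 :=
    hj.comp (PolyTime.fst.comp .fst)
  have hl : PolyTime fun x : (α × ℕ × List Lit) × Lit => x.2.2 := PolyTime.snd.comp .snd
  have hl' : PolyTime fun x : (α × ℕ × List Lit) × Lit => x.2.1 := PolyTime.fst.comp .snd
  have h1 : PolyTime fun x : α × ℕ × List Lit => pattern x.2.2 (j x.1).val :=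
    hC.map (g := fun (x : α × ℕ × List Lit) (l : Lit) => (l.1, decide (l.2.val = (j x.1).val)))
      (hl'.pair (hl.unaryEq hj'))
  have h2 : PolyTime fun x : α × ℕ × List Lit =>
      G.map fun g => F g (pattern x.2.2 (j x.1).val) := by
    have := (PolyTime.table k fun P => G.map fun g => F g P).comp h1
    simpa only [hF] using this
  have hL' : PolyTime fun x : (α × ℕ × List Lit) × ℤ => L x.1.1 := hL.comp (PolyTime.fst.comp .fst)
  have hw : PolyTime fun x : (α × ℕ × List Lit) × ℤ => x.1.2.1 :=
    PolyTime.fst.comp (PolyTime.snd.comp .fst)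
  have h3 : PolyTime fun x : (α × ℕ × List Lit) × ℤ =>
      FineGrained.scaled p (2 ^ (c * (L x.1.1).val)) x.1.2.1 x.2 := .scaled hp h c hL' hw .snd
  have h4 := h2.map (g := fun (x : α × ℕ × List Lit) (m : ℤ) =>
    FineGrained.scaled p (2 ^ (c * (L x.1).val)) x.2.1 m) h3
  have h5 : PolyTime fun x : α × ℕ × List Lit => G.map fun g =>
      FineGrained.scaled p (2 ^ (c * (L x.1).val)) x.2.1 (F g (pattern x.2.2 (j x.1).val)) :=
    h4.of_eq fun x => by rw [List.map_map]; rfl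
  exact hitems.flatMap h5

theorem PolyTime.itemsBound {u : α → Unary} {items : α → List (ℕ × List Lit)} (hu : PolyTime u)
    (hitems : PolyTime items) :
    PolyTime fun a => Unary.mk (FineGrained.itemsBound (u a).val (items a)) :=
  (((hitems.flatMap (g := fun _ it => true :: it.1.bits)
    (.cons (.const true) (PolyTime.bits (PolyTime.fst.comp .snd)))).append
      (PolyTime.map (g := fun _ _ => true) hu.unaryToList (.const true))).unaryLength).of_eq
        fun a => by simp [FineGrained.itemsBound]

variable {u : α → Unary} {cl : α → List (ℕ × List Lit)} {W : α → ℕ}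

theorem PolyTime.latticeItems (hu : PolyTime u) (hcl : PolyTime cl) (hW : PolyTime W) :
    PolyTime fun a => FineGrained.latticeItems k (u a).val (cl a) (W a) := by
  have h1 : PolyTime fun x : α × ℕ × List Lit => x.2.1 := PolyTime.fst.comp .snd
  have h2 : PolyTime fun x : α × ℕ × List Lit => x.2.2 := PolyTime.snd.comp .snd
  exact (hcl.map (g := fun _ (c : ℕ × List Lit) => (2 * c.1, c.2)) (h1.double.pair h2)).append
    (.cons (hW.double.pair (hu.constClause false))
      (.cons ((PolyTime.const 1).pair (hu.constClause true)) (.const [])))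

theorem PolyTime.boundItems (hu : PolyTime u) (hcl : PolyTime cl) (hW : PolyTime W) :
    PolyTime fun a => FineGrained.boundItems k (u a).val (cl a) (W a) := by
  have h1 : PolyTime fun x : α × ℕ × List Lit => x.2.1 := PolyTime.fst.comp .snd
  have h2 : PolyTime fun x : α × ℕ × List Lit => u x.1 := hu.comp .fst
  exact (hcl.map (g := fun a (c : ℕ × List Lit) =>
    (2 * c.1, FineGrained.constClause k (u a).val false)) (h1.double.pair
      (h2.constClause false))).append (.cons (hW.double.pair (hu.constClause true))
        (.cons ((PolyTime.const 1).pair (hu.constClause false)) (.const [])))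

theorem rows_map_latticeEntry (p : ℝ) (a M n j : ℕ) (G : List ((Fin k → ℤ) × ℤ))
    (items : List (ℕ × List Lit)) :
    (rows n G items).map (latticeEntry p a M j) =
      (((List.range n).map Unary.mk).map fun i => if i.val = j then 2 * (a : ℤ) else 0) ++
        items.flatMap fun it => G.map fun g =>
          scaled p M it.1 (gadgetCoef g (pattern it.2 j)) := by
  simp [rows, List.map_flatMap, Function.comp_def, latticeEntry]

theorem rows_map_targetEntry (p : ℝ) (a M n : ℕ) (G : List ((Fin k → ℤ) × ℤ))
    (items : List (ℕ × List Lit)) :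
    (rows n G items).map (targetEntry p a M n) =
      (((List.range n).map Unary.mk).map fun _ => (a : ℤ)) ++
        items.flatMap fun it => G.map fun g =>
          scaled p M it.1 (gadgetConst g (pattern it.2 n)) := by
  simp [rows, List.map_flatMap, Function.comp_def, targetEntry]

theorem PolyTime.latticeVector (hp : 1 ≤ p) (h : (CVP p).SolvableInTimeTwoPow δ) (c c' : ℕ)
    (G : List ((Fin k → ℤ) × ℤ)) {L j : α → Unary} {items : α → List (ℕ × List Lit)}
    (hL : PolyTime L) (hu : PolyTime u) (hj : PolyTime j) (hitems : PolyTime items) :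
    PolyTime fun a => (rows (u a).val G (items a)).map
      (latticeEntry p (2 ^ (c * (L a).val)) (2 ^ (c' * (L a).val)) (j a).val) := by
  refine ((hu.range.map (g := fun a i => if decide (i.val = (j a).val) = true then
    ((2 * 2 ^ (c * (L a).val) : ℕ) : ℤ) else 0) (.ite (.unaryEq .snd (hj.comp .fst))
      (.intOfNat (.double (.twoPow c (hL.comp .fst)))) (.const 0))).append
        (.gadgetRows hp h c' G gadgetCoef gadgetCoef_take hL hj hitems)).of_eq fun a => ?_
  rw [rows_map_latticeEntry]
  simp

theorem PolyTime.targetVector (hp : 1 ≤ p) (h : (CVP p).SolvableInTimeTwoPow δ) (c c' : ℕ)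
    (G : List ((Fin k → ℤ) × ℤ)) {L : α → Unary} {items : α → List (ℕ × List Lit)}
    (hL : PolyTime L) (hu : PolyTime u) (hitems : PolyTime items) :
    PolyTime fun a => (rows (u a).val G (items a)).map
      (targetEntry p (2 ^ (c * (L a).val)) (2 ^ (c' * (L a).val)) (u a).val) := by
  refine ((hu.range.map (g := fun a _ => ((2 ^ (c * (L a).val) : ℕ) : ℤ))
      (.intOfNat (.twoPow c (hL.comp .fst)))).append
        (.gadgetRows hp h c' G gadgetConst gadgetConst_take hL hu hitems)).of_eq fun a => ?_
  rw [rows_map_targetEntry]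

theorem PolyTime.distanceBound (hp : 1 ≤ p) (h : (CVP p).SolvableInTimeTwoPow δ) (c c' : ℕ)
    (G : List ((Fin k → ℤ) × ℤ)) {L : α → Unary} {items : α → List (ℕ × List Lit)}
    (hL : PolyTime L) (hu : PolyTime u) (hitems : PolyTime items) :
    PolyTime fun a => FineGrained.distanceBound p (2 ^ (c * (L a).val)) (2 ^ (c' * (L a).val))
      (u a).val G (items a) := by
  refine (PolyTime.normFloor hp h ((PolyTime.targetVector hp h c c' G hL hu hitems).map
    (g := fun _ z => z.natAbs) (.natAbs .snd))).of_eq fun a => ?_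
  rw [List.map_map]
  rfl

end Program

/-! ### The instance of the closest vector problem -/

section Instance
variable {k : ℕ} {p : ℝ}

theorem ofFn_get_comp {α β : Type} (l : List α) (f : α → β) :
    List.ofFn (fun i => f (l.get i)) = l.map f := by
  conv_rhs => rw [← List.ofFn_get l, List.map_ofFn]
  rfl

/-- The instance with the given coordinates. -/
noncomputable def rowsInstance (p : ℝ) (a M n r : ℕ) (G : List ((Fin k → ℤ) × ℤ))
    (items : List (ℕ × List Lit)) (ha : 0 < a) (hr : 0 < r) : CVPInstance where
  d := (rows n G items).length
  n := n
  B i j := ((latticeEntry p a M j ((rows n G items).get i) : ℤ) : ℚ)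
  t i := ((targetEntry p a M n ((rows n G items).get i) : ℤ) : ℚ)
  r := ((r : ℤ) : ℚ)
  linearIndependent := by
    rw [Fintype.linearIndependent_iff]
    intro g hg j
    -- The first `n` rows of the basis form `2 * a` times the identity matrix.
    have hlen : (j : ℕ) < (rows n G items).length := by
      simp [rows]; omega
    have hrow : (rows n G items).get ⟨j, hlen⟩ = Sum.inl (Unary.mk j) := by
      simp [rows]
    have h := congrFun hg ⟨j, hlen⟩
    simp only [Finset.sum_apply, Pi.smul_apply, hrow, latticeEntry, smul_eq_mul,
      Pi.zero_apply] at h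
    rw [Finset.sum_eq_single j] at h
    · have ha' : (a : ℝ) ≠ 0 := by positivity
      simpa [ha'] using h
    · intro i _ hi
      have : (j : ℕ) ≠ i := fun h => hi (Fin.ext h.symm)
      simp [this]
    · simp
  r_pos := by exact_mod_cast hr

theorem rowsInstance_encode (a M n r : ℕ) (G : List ((Fin k → ℤ) × ℤ))
    (items : List (ℕ × List Lit)) (ha : 0 < a) (hr : 0 < r) :
    (CVP p).encode (rowsInstance p a M n r G items ha hr) =
      enc ((((List.range n).map Unary.mk).map fun j => ((rows n G items).map
        (latticeEntry p a M j.val)).map fun z : ℤ => (z : ℚ)),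
        ((rows n G items).map (targetEntry p a M n)).map (fun z : ℤ => (z : ℚ)), ((r : ℤ) : ℚ)) := by
  rw [enc_pair, enc_pair, List.map_map (l := rows n G items), ← encVec_get]
  show Data.cons (encList _) (Data.cons _ _) = _
  congr 1
  have h : ∀ j : Fin n, (encVec fun i => ((latticeEntry p a M j ((rows n G items).get i) : ℤ) : ℚ)) =
      enc (((rows n G items).map (latticeEntry p a M j)).map fun z : ℤ => (z : ℚ)) := by
    intro j
    rw [List.map_map, ← encVec_get]
    rfl
  show encList (List.ofFn fun j : Fin n =>
    encVec fun i => ((latticeEntry p a M j ((rows n G items).get i) : ℤ) : ℚ)) = _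
  simp only [h, enc]
  congr 1
  refine List.ext_getElem (by simp) fun i h1 h2 => ?_
  simp

/-- The gap between `r` and `r + 1` allows to argue with the infimum directly, without showing that
it is attained. -/
theorem rowsInstance_yes (hp : 1 ≤ p) (a M n r : ℕ) (G : List ((Fin k → ℤ) × ℤ))
    (items : List (ℕ × List Lit)) (ha : 0 < a) (hr : 0 < r) :
    ((∃ z : Fin n → ℤ, listNorm p ((rows n G items).map
        fun r => ((rowValue p a M z r : ℤ) : ℝ)) ≤ r) →
      (CVP p).Yes (rowsInstance p a M n r G items ha hr)) ∧
    ((∀ z : Fin n → ℤ, (r + 1 : ℝ) ≤ listNorm p ((rows n G items).map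
        fun r => ((rowValue p a M z r : ℤ) : ℝ))) →
      ¬ (CVP p).Yes (rowsInstance p a M n r G items ha hr)) := by
  set I := rowsInstance p a M n r G items ha hr with hI
  have hnorm : ∀ z : Fin n → ℤ, lpNorm p (((I.B.map fun q : ℚ => (q : ℝ)) *ᵥ
      (fun j => ((z j : ℤ) : ℝ)) : Fin I.d → ℝ) - fun i => ((I.t i : ℚ) : ℝ)) =
      listNorm p ((rows n G items).map fun r => ((rowValue p a M z r : ℤ) : ℝ)) := by
    intro z
    rw [← ofFn_get_comp, listNorm_ofFn hp]
    show lpNorm p _ = lpNorm p _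
    congr 1
    funext i
    simp only [Pi.sub_apply, Matrix.mulVec, dotProduct, Matrix.map_apply, rowValue]
    push_cast
    rfl
  have hset : (fun x => lpNorm p (x - fun i => ((I.t i : ℚ) : ℝ))) ''
      latticeOf (I.B.map fun q : ℚ => (q : ℝ)) = Set.range fun z : Fin n → ℤ =>
        listNorm p ((rows n G items).map fun r => ((rowValue p a M z r : ℤ) : ℝ)) := by
    rw [latticeOf, ← Set.range_comp]
    exact congrArg Set.range (funext hnorm)
  have hyes : (CVP p).Yes I ↔ sInf (Set.range fun z : Fin n → ℤ =>
      listNorm p ((rows n G items).map fun r => ((rowValue p a M z r : ℤ) : ℝ))) ≤ (r : ℝ) := by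
    show lpDist p _ _ ≤ _ ↔ _
    rw [lpDist, hset]
    simp [hI, rowsInstance]
  rw [hyes]
  constructor
  · rintro ⟨z, hz⟩
    refine (csInf_le ⟨0, ?_⟩ (Set.mem_range_self z)).trans hz
    rintro _ ⟨z, rfl⟩
    exact listNorm_nonneg _
  · intro h hle
    have := le_csInf (Set.range_nonempty _) (Set.forall_mem_range.2 h)
    linarith

end Instance

/-! ### The complete reduction from weighted Max-`k`-SAT. -/

/-- The literals of a clause. -/
def clauseLits {k n : ℕ} (C : Clause k n) : List Lit :=
  List.ofFn fun i => ((C i).2, Unary.mk (C i).1)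

theorem enc_clauseLits {k n : ℕ} (C : Clause k n) : enc (clauseLits C) = encClause C := by
  simp only [enc, clauseLits, encClause, List.map_ofFn]
  rfl

/-- The clauses of an instance, with their weights. -/
def WeightedKCNF.items {k : ℕ} (Φ : WeightedKCNF k) : List (ℕ × List Lit) :=
  Φ.clauses.map fun c => (c.1, clauseLits c.2)

theorem WeightedKCNF.encode_eq {k : ℕ} (Φ : WeightedKCNF k) :
    (weightedMaxKSAT k).encode Φ = enc (Unary.mk Φ.n, Φ.items, Φ.threshold) := by
  rw [enc_pair, enc_pair]
  show Data.cons _ (Data.cons (encList _) _) = Data.cons _ (Data.cons (encList _) _)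
  rw [WeightedKCNF.items, List.map_map]
  simp only [Function.comp_def, enc_pair, enc_clauseLits]
  rfl

theorem satWeight_items {k : ℕ} (Φ : WeightedKCNF k) (y : Fin Φ.n → Bool) (y' : ℕ → Bool)
    (hy : ∀ j : Fin Φ.n, y' j = y j) : satWeight y' Φ.items = Φ.weight y := by
  classical
  have h : ∀ C : Clause k Φ.n, satisfies y' (clauseLits C) ↔ C.sat y = true := by
    intro C
    simp [satisfies, clauseLits, Clause.sat, hy]
  rw [satWeight, WeightedKCNF.items, WeightedKCNF.weight, List.map_map]
  simp only [Function.comp_def, h]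

/-- The gadget and the constants `c₁`, `c₂` depend only on `p` and `k`, so they are built into the
program. The assumed algorithm is used twice: in rank `0` to write down the instance, and in rank
`n` to solve it. -/
theorem weightedMaxKSAT_solvable {p δ : ℝ} (hp : 1 ≤ p) (hev : ∀ m : ℤ, p ≠ 2 * (m : ℝ))
    (hδ : 0 ≤ δ) (h : (CVP p).SolvableInTimeTwoPow δ) {k : ℕ} (hk : 1 ≤ k) :
    (weightedMaxKSAT k).SolvableInTimeTwoPow δ := by
  obtain ⟨G, A, D, hA, hD, hG⟩ := exists_gadget hev k
  obtain ⟨c₁, c₂, hc⟩ := reduction_spec hp hk hA hD hG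
  let L : WeightedKCNF k → ℕ := fun Φ => itemsBound Φ.n (latticeItems k Φ.n Φ.items Φ.threshold)
  let r : WeightedKCNF k → ℕ := fun Φ => distanceBound p (2 ^ (c₁ * L Φ)) (2 ^ (c₂ * L Φ)) Φ.n G
    (boundItems k Φ.n Φ.items Φ.threshold)
  have hspec := fun Φ : WeightedKCNF k => hc Φ.n Φ.items Φ.threshold (L Φ) _ _ (r Φ) (by
    intro c hc
    obtain ⟨c', -, rfl⟩ := List.mem_map.1 hc
    simp [clauseLits]) rfl rfl rfl rfl
  let f : WeightedKCNF k → CVPInstance := fun Φ => rowsInstance p (2 ^ (c₁ * L Φ)) (2 ^ (c₂ * L Φ))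
    Φ.n (r Φ) G (latticeItems k Φ.n Φ.items Φ.threshold) (by positivity) (hspec Φ).1
  refine h.of_reduction (P := weightedMaxKSAT k) hδ f ?_ (fun Φ => rfl) fun Φ => ?_
  · let _ : Enc (WeightedKCNF k) := ⟨(weightedMaxKSAT k).encode⟩
    have hraw : PolyTime fun Φ : WeightedKCNF k => (Unary.mk Φ.n, Φ.items, Φ.threshold) :=
      PolyTime.id.congr_enc fun Φ => Φ.encode_eq.symm
    have hu : PolyTime fun Φ : WeightedKCNF k => Unary.mk Φ.n := PolyTime.fst.comp hraw
    have hcl : PolyTime fun Φ : WeightedKCNF k => Φ.items :=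
      PolyTime.fst.comp (PolyTime.snd.comp hraw)
    have hW : PolyTime fun Φ : WeightedKCNF k => Φ.threshold :=
      PolyTime.snd.comp (PolyTime.snd.comp hraw)
    have hI : PolyTime fun Φ : WeightedKCNF k => latticeItems k Φ.n Φ.items Φ.threshold :=
      hu.latticeItems hcl hW
    have hT : PolyTime fun Φ : WeightedKCNF k => boundItems k Φ.n Φ.items Φ.threshold :=
      hu.boundItems hcl hW
    have hL : PolyTime fun Φ : WeightedKCNF k => Unary.mk (L Φ) := hu.itemsBound hI
    have hcol : PolyTime fun x : WeightedKCNF k × Unary => ((rows x.1.n G (latticeItems k x.1.n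
        x.1.items x.1.threshold)).map (latticeEntry p (2 ^ (c₁ * L x.1)) (2 ^ (c₂ * L x.1))
          x.2.val)).map fun z : ℤ => (z : ℚ) :=
      (PolyTime.latticeVector hp h c₁ c₂ G (hL.comp .fst) (hu.comp .fst) .snd
        (hI.comp .fst)).map (g := fun _ (z : ℤ) => (z : ℚ)) (.ratOfInt .snd)
    have hcols := hu.range.map (g := fun Φ j => ((rows Φ.n G (latticeItems k Φ.n Φ.items
      Φ.threshold)).map (latticeEntry p (2 ^ (c₁ * L Φ)) (2 ^ (c₂ * L Φ)) j.val)).map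
        fun z : ℤ => (z : ℚ)) hcol
    have ht := (PolyTime.targetVector hp h c₁ c₂ G hL hu hI).map (g := fun _ (z : ℤ) => (z : ℚ))
      (.ratOfInt .snd)
    have hr := (PolyTime.distanceBound hp h c₁ c₂ G hL hu hT).intOfNat.ratOfInt
    change PolyTime (α := WeightedKCNF k) (β := CVPInstance) f
    exact (hcols.pair (ht.pair hr)).congr_enc fun Φ => rowsInstance_encode (p := p) _ _ _ _ _ _ _ _
  · obtain ⟨hyes, hno⟩ := rowsInstance_yes hp (2 ^ (c₁ * L Φ)) (2 ^ (c₂ * L Φ)) Φ.n (r Φ) G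
      (latticeItems k Φ.n Φ.items Φ.threshold) (by positivity) (hspec Φ).1
    constructor
    · intro hY
      by_contra hcon
      refine hno (fun z => ((hspec Φ).2 z).2 fun y _ _ => ?_) hY
      by_contra hlt
      exact hcon ⟨fun j => y j, by
        rw [← satWeight_items Φ (fun j => y j) y fun _ => rfl]; exact not_lt.1 hlt⟩
    · rintro ⟨y, hy⟩
      let y' : ℕ → Bool := fun v => if h : v < Φ.n then y ⟨v, h⟩ else false
      refine hyes ⟨fun j => if y' j = true then 1 else 0, ((hspec Φ).2 _).1 y' (fun v hv => ?_) ?_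
        fun _ => rfl⟩
      · simp [y', hv]
      · rw [satWeight_items Φ y y' fun j => by simp [y']]
        exact hy

/-! ## From `k`-SAT to weighted Max-`k`-SAT -/

/-- Put decreasing powers of two in front of the members of a list, until there are `m` of them. -/
def attachPowers {α : Type} (m : ℕ) (acc : List (ℕ × α)) (l : List α) : List (ℕ × α) :=
  l.foldl (fun s c => (2 ^ (m - 1 - s.length), c) :: s) acc

section Powers
variable {α β : Type}

theorem attachPowers_cons (m : ℕ) (acc : List (ℕ × α)) (a : α) (l : List α) :
    attachPowers m acc (a :: l) = attachPowers m ((2 ^ (m - 1 - acc.length), a) :: acc) l := rfl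

theorem map_attachPowers (f : α → β) (m : ℕ) (l : List α) : ∀ acc : List (ℕ × α),
    (attachPowers m acc l).map (fun c => (c.1, f c.2)) =
      attachPowers m (acc.map fun c => (c.1, f c.2)) (l.map f) := by
  induction l with
  | nil => intro acc; rfl
  | cons a l ih => intro acc; simp [attachPowers_cons, ih]

theorem attachPowers_snd (m : ℕ) (l : List α) : ∀ acc : List (ℕ × α),
    (attachPowers m acc l).map Prod.snd = l.reverse ++ acc.map Prod.snd := by
  induction l with
  | nil => intro acc; rfl
  | cons a l ih => intro acc; simp [attachPowers_cons, ih]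

theorem attachPowers_pos (m : ℕ) (l : List α) : ∀ acc : List (ℕ × α), (∀ c ∈ acc, 0 < c.1) →
    ∀ c ∈ attachPowers m acc l, 0 < c.1 := by
  induction l with
  | nil => intro acc h; exact h
  | cons a l ih =>
    intro acc h
    rw [attachPowers_cons]
    refine ih _ fun c hc => ?_
    rcases List.mem_cons.1 hc with rfl | hc
    · positivity
    · exact h c hc

/-- The members of `l` receive the weights `2 ^ (l.length - 1), …, 2, 1`. Powers of two are used
because their total has only ones in binary, so no addition has to be programmed. -/
theorem attachPowers_sum (m : ℕ) (l : List α) : ∀ acc : List (ℕ × α), acc.length + l.length = m →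
    ((attachPowers m acc l).map Prod.fst).sum + 1 = (acc.map Prod.fst).sum + 2 ^ l.length := by
  induction l with
  | nil => intro acc _; simp [attachPowers]
  | cons a l ih =>
    intro acc h
    rw [List.length_cons] at h
    rw [attachPowers_cons, ih _ (by simp; omega), List.length_cons, pow_succ]
    have : m - 1 - acc.length = l.length := by omega
    simp [this]; ring

/-- As all weights are positive, a single violated clause makes the satisfied weight fall short of
the total. The first inequality is what the induction needs. -/
theorem sum_le_sum_ite_iff (b : α → Bool) (l : List (ℕ × α)) (hl : ∀ c ∈ l, 0 < c.1) :
    (l.map fun c => if b c.2 = true then c.1 else 0).sum ≤ (l.map Prod.fst).sum ∧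
    ((l.map Prod.fst).sum ≤ (l.map fun c => if b c.2 = true then c.1 else 0).sum ↔
      ∀ c ∈ l.map Prod.snd, b c = true) := by
  induction l with
  | nil => simp
  | cons c l ih =>
    obtain ⟨h1, h2⟩ := ih fun c hc => hl c (List.mem_cons_of_mem _ hc)
    have h3 := hl c List.mem_cons_self
    simp only [List.map_cons, List.sum_cons, List.forall_mem_cons]
    by_cases hb : b c.2 = true
    · simp only [hb, if_true, true_and, ← h2]
      omega
    · simp only [hb, Bool.false_eq_true, if_false, false_and, iff_false]
      omega

theorem PolyTime.attachPowers [Enc α] [Enc β] {l : β → List α} (hl : PolyTime l) :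
    PolyTime fun a => FineGrained.attachPowers (l a).length [] (l a) := by
  have key : PolyTime fun l : List α => FineGrained.attachPowers l.length [] l := by
    have hs : PolyTime fun x : List α × List (ℕ × α) × α => x.2.1 := PolyTime.fst.comp .snd
    have hm : PolyTime fun x : List α × List (ℕ × α) × α => Unary.mk (x.1.length - 1) :=
      PolyTime.unarySub (α := List α × List (ℕ × α) × α) (u := fun x => Unary.mk x.1.length) (v := fun _ => Unary.mk 1)
        (PolyTime.unaryLength .fst) (.const _)
    have hw : PolyTime fun x : List α × List (ℕ × α) × α =>
        2 ^ (x.1.length - 1 - x.2.1.length) :=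
      ((PolyTime.const 1).shift (hm.unarySub hs.unaryLength)).of_eq fun x => by simp
    refine PolyTime.foldl (l := fun l => l) (s₀ := fun _ => []) .id (.const [])
      ((hw.pair (PolyTime.snd.comp .snd)).cons hs) (Polynomial.C 4 * Polynomial.X + Polynomial.C 3)
        fun x s c => ?_
    have h1 : esize (2 ^ (x.length - 1 - s.length)) ≤ 4 * (x.length + 1) + 1 :=
      esize_nat_le (Nat.pow_lt_pow_right (by norm_num) (by omega))
    have h2 := length_lt_esize x
    simp only [Polynomial.eval_add, Polynomial.eval_mul, Polynomial.eval_C, Polynomial.eval_X,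
      esize_cons, esize_pair]
    omega
  exact key.comp hl

end Powers

theorem PolyTime.twoPowLengthSub {α β : Type} [Enc α] [Enc β] {l : β → List α}
    (hl : PolyTime l) : PolyTime fun a => 2 ^ (l a).length - 1 := by
  refine (PolyTime.foldl (s₀ := fun _ => 0) (f := fun x : β × ℕ × α => Nat.bit true x.2.1) hl
    (.const 0) (.bit (.const true) (PolyTime.fst.comp .snd)) (Polynomial.C 4) fun x s c => by
      rw [Polynomial.eval_C]; exact esize_bit_le _ _).of_eq fun a => ?_
  have : ∀ (l : List α) (s : ℕ),
      l.foldl (fun s _ => Nat.bit true s) s + 1 = (s + 1) * 2 ^ l.length := by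
    intro l
    induction l with
    | nil => simp
    | cons c l ih =>
      intro s
      rw [List.foldl_cons, ih, Nat.bit_val, List.length_cons, pow_succ]
      simp; ring
  have h := this (l a) 0
  simp only [zero_add, one_mul] at h
  change _ = (l a).foldl (fun s _ => Nat.bit true s) 0
  omega

/-- All clauses are satisfied if the satisfied clauses have the total weight of all clauses. -/
def KCNF.weighted {k : ℕ} (Φ : KCNF k) : WeightedKCNF k where
  n := Φ.n
  clauses := attachPowers Φ.clauses.length [] Φ.clauses
  threshold := 2 ^ Φ.clauses.length - 1

theorem KCNF.encode_eq {k : ℕ} (Φ : KCNF k) :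
    (kSAT k).encode Φ = enc (Unary.mk Φ.n, Φ.clauses.map clauseLits) := by
  rw [enc_pair]
  show Data.cons _ (encList _) = Data.cons _ (encList _)
  rw [List.map_map]
  simp only [Function.comp_def, enc_clauseLits]
  rfl

theorem kSAT_solvable {k : ℕ} {δ : ℝ} (hδ : 0 ≤ δ)
    (h : (weightedMaxKSAT k).SolvableInTimeTwoPow δ) : (kSAT k).SolvableInTimeTwoPow δ := by
  refine h.of_reduction (P := kSAT k) hδ KCNF.weighted ?_ (fun Φ => rfl) fun Φ => ?_
  · let _ : Enc (KCNF k) := ⟨(kSAT k).encode⟩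
    let _ : Enc (WeightedKCNF k) := ⟨(weightedMaxKSAT k).encode⟩
    have hraw : PolyTime fun Φ : KCNF k => (Unary.mk Φ.n, Φ.clauses.map clauseLits) :=
      PolyTime.id.congr_enc fun Φ => Φ.encode_eq.symm
    have hcl : PolyTime fun Φ : KCNF k => Φ.clauses.map clauseLits := PolyTime.snd.comp hraw
    change PolyTime (α := KCNF k) (β := WeightedKCNF k) KCNF.weighted
    refine ((PolyTime.fst.comp hraw).pair (hcl.attachPowers.pair hcl.twoPowLengthSub)).congr_enc
      fun Φ => Φ.weighted.encode_eq.trans ?_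
    simp [KCNF.weighted, WeightedKCNF.items, map_attachPowers]
  · have h1 := attachPowers_sum Φ.clauses.length Φ.clauses [] (by simp)
    have h2 : ((attachPowers Φ.clauses.length [] Φ.clauses).map Prod.fst).sum =
        2 ^ Φ.clauses.length - 1 := by
      simp only [List.map_nil, List.sum_nil, zero_add] at h1
      omega
    have h3 := fun y : Fin Φ.n → Bool => (sum_le_sum_ite_iff (fun C : Clause k Φ.n => C.sat y) _
      (attachPowers_pos Φ.clauses.length Φ.clauses [] (by simp))).2
    simp only [h2, attachPowers_snd, List.map_nil, List.append_nil, List.mem_reverse] at h3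
    exact exists_congr h3

theorem WMaxSATSETH.of_SETH (h : SETH) : WMaxSATSETH := by
  intro ε hε
  -- Replacing `ε` by `min ε 1` keeps the exponent nonnegative, as the reduction requires; a faster
  -- algorithm is in particular one with this exponent.
  obtain ⟨k, hk, hn⟩ := h (min ε 1) (lt_min hε one_pos)
  refine ⟨k, hk, fun hs => hn (kSAT_solvable ?_ (hs.mono ?_))⟩
  · linarith [min_le_right ε 1]
  · linarith [min_le_left ε 1]

theorem not_CVP_solvable (h : WMaxSATSETH) {ε p : ℝ} (hε : 0 < ε) (hp : 1 ≤ p)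
    (hev : ∀ m : ℤ, p ≠ 2 * (m : ℝ)) : ¬ (CVP p).SolvableInTimeTwoPow (1 - ε) := by
  intro hs
  obtain ⟨k, hk, hn⟩ := h (min ε 1) (lt_min hε one_pos)
  refine hn (weightedMaxKSAT_solvable hp hev ?_ (hs.mono ?_) hk)
  · linarith [min_le_right ε 1]
  · linarith [min_le_left ε 1]

end FineGrained

theorem mainTheorem2 :
    (FineGrained.WMaxSATSETH →
      ∀ ε : ℝ, 0 < ε → ∀ p : ℝ, 1 ≤ p → (∀ m : ℤ, p ≠ 2 * (m : ℝ)) →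
        FineGrained.IsComputableReal p →
          ¬ (FineGrained.CVP p).SolvableInTimeTwoPow (1 - ε)) ∧
    (FineGrained.SETH →
      ∀ ε : ℝ, 0 < ε → ∀ p : ℝ, 1 ≤ p → (∀ m : ℤ, p ≠ 2 * (m : ℝ)) →
        FineGrained.IsComputableReal p →
          ¬ (FineGrained.CVP p).SolvableInTimeTwoPow (1 - ε)) :=
  ⟨fun h _ hε _ hp hev _ => FineGrained.not_CVP_solvable h hε hp hev,
    fun h _ hε _ hp hev _ => FineGrained.not_CVP_solvable (.of_SETH h) hε hp hev⟩
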